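/- Let $d\in\mathbb N$ and let $\mathcal F\subset C([0,1]^d)$ be a linear space of continuous functions endowed with a seminorm $|\cdot|_{\mathcal F}$, with unit ball $B_{\mathcal F}=\{f\in\mathcal F:|f|_{\mathcal F}\le 1\}$. For $\delta>0$ let $H_\infty(\delta,B_{\mathcal F})=\log N(\delta,B_{\mathcal F},\|\cdot\|_\infty)$, where $N(\delta,B_{\mathcal F},\|\cdot\|_\infty)$ is the minimal number of sup-norm balls of radius $\delta$ needed to cover $B_{\mathcal F}$. Assume that for some $\beta\in(0,2)$ and $D>0$ $$H_\infty(\delta,B_{\mathcal F})\le D\,\delta^{-\beta}\qquad\text{for all }\delta>0 .$$ Let $f_0\in\mathcal F$ and let $(X_1,Y_1),\dots,(X_n,Y_n)$ be i.i.d. with $Y_i=f_0(X_i)+\sigma\varepsilon_i$, $\sigma>0$, where $X_i$ takes values in $[0,1]^d$ and has an arbitrary law $P_X$, and where, conditionally on $X_i$, the noise $\varepsilon_i$ is symmetric and subgaussian: there is $b_\varepsilon>0$ with $E[\exp(t\varepsilon_i)\mid X_i]\le\exp(b_\varepsilon^2t^2/2)$ a.s. for all $t>0$. Put $b=\sigma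 b_\varepsilon$. Let $h=a\,n^{-1/(2+\beta)}$ with $a>0$, let $\alpha>2\beta/(\beta+2)$, and let $\bar f$ be a (measurable) minimizer over $f\in\mathcal F$ of $$\frac1n\sum_{i=1}^n\big(Y_i-f(X_i)\big)^2+h^2|f|_{\mathcal F}^\alpha .$$ Write $\|f\|_n^2=\frac1n\sum_{i=1}^n f(X_i)^2$ and $\|f\|^2=\int f^2\,dP_X$, let $E_n$ be the conditional expectation given $(X_1,\dots,X_n)$ and $E^n$ the expectation with respect to the whole sample. (1) There are $C_1>0$ and $n_1$, depending only on $a,\beta,\alpha,b,D$, such that for all $n\ge n_1$, almost surely, $$E_n\|\bar f-f_0\|_n^2\le C_1\big(1+|f_0|_{\mathcal F}^\alpha\big)\,n^{-2/(2+\beta)} .$$ (2) For every $Q>0$ there are $C_2>0$ and $n_2$, depending only on $a,\beta,\alpha,b,D,Q$, such that if moreover $\|\bar f-f_0\|_\infty\le Q$ a.s., then for all $n\ge n_2$ $$E^n\|\bar f-f_0\|^2\le C_2\big(1+|f_0|_{\mathcal F}^\alpha\big)\,n^{-2/(2+\beta)} .$$ -/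

import Mathlib

open MeasureTheory ProbabilityTheory
open scoped NNReal ENNReal

universe u

noncomputable section

namespace PERM

/-- The unit cube `[0,1]^d`, with its product topology and Borel sigma-algebra. -/
abbrev Cube (d : ℕ) : Type := Fin d → unitInterval

/-- The `δ`-entropy `H(δ, A) = log N(δ, A)`, where `N(δ, A)` is the minimal number of (closed)
balls of radius `δ`, with centres anywhere in the ambient space, that cover `A`.
It is `⊤` when there is no finite cover. -/
def entropy {E : Type*} [PseudoEMetricSpace E] (δ : ℝ≥0) (A : Set E) : EReal :=
  ENNReal.log ((Metric.externalCoveringNumber δ A : ℕ∞) : ℝ≥0∞)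

/-- The unit ball `{f ∈ F : |f|_F ≤ 1}`, as a set of continuous functions on the cube. -/
def unitBall {d : ℕ} (F : Submodule ℝ C(Cube d, ℝ)) (p : Seminorm ℝ F) : Set C(Cube d, ℝ) :=
  (fun f : F => (f : C(Cube d, ℝ))) '' {f : F | p f ≤ 1}

/-- The complexity assumption: `H_∞(δ, B_F) ≤ D δ^{-β}` for every `δ > 0`. The distance
on `C(Cube d, ℝ)` is the one of the supremum norm. -/
def EntropyBound {d : ℕ} (F : Submodule ℝ C(Cube d, ℝ)) (p : Seminorm ℝ F) (D β : ℝ) : Prop :=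
  ∀ δ : ℝ≥0, 0 < δ → entropy δ (unitBall F p) ≤ ((D * (δ : ℝ) ^ (-β) : ℝ) : EReal)

/-- `ε` is symmetric conditionally on `X`: `ε` and `-ε` have the same conditional law given `X`,
that is, `(X, ε)` and `(X, -ε)` have the same law. -/
def CondSymmetric {Ω S : Type*} [MeasurableSpace Ω] [MeasurableSpace S] (μ : Measure Ω)
    (X : Ω → S) (ε : Ω → ℝ) : Prop :=
  IdentDistrib (fun ω => (X ω, ε ω)) (fun ω => (X ω, -ε ω)) μ μ

/-- `E[exp(t ε) | X] ≤ exp(b² t² / 2)` almost surely, for every `t > 0`. -/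
def CondSubgaussian {Ω S : Type*} [MeasurableSpace Ω] [MeasurableSpace S] (μ : Measure Ω)
    (X : Ω → S) (ε : Ω → ℝ) (b : ℝ) : Prop :=
  ∀ t : ℝ, 0 < t →
    Integrable (fun ω => Real.exp (t * ε ω)) μ ∧
      μ[fun ω => Real.exp (t * ε ω) | MeasurableSpace.comap X inferInstance]
        ≤ᵐ[μ] fun _ => Real.exp (b ^ 2 * t ^ 2 / 2)

/-- `(X_1, Y_1), …, (X_n, Y_n)` is an i.i.d. sample of the regression model
`Y = f₀(X) + σ ε`, with design law `PX` on the cube and with noise `ε` which is, conditionally on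
`X`, symmetric and subgaussian with constant `bε`. -/
structure IsRegressionSample {Ω : Type*} [MeasurableSpace Ω] (μ : Measure Ω) {d n : ℕ}
    (PX : Measure (Cube d)) (f₀ : C(Cube d, ℝ)) (σ bε : ℝ)
    (X : Fin n → Ω → Cube d) (ε Y : Fin n → Ω → ℝ) : Prop where
  measurable_X : ∀ i, Measurable (X i)
  measurable_noise : ∀ i, Measurable (ε i)
  model : ∀ i ω, Y i ω = f₀ (X i ω) + σ * ε i ω
  law_X : ∀ i, μ.map (X i) = PX
  indep : iIndepFun (fun i ω => (X i ω, Y i ω)) μ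
  identDistrib : ∀ i j,
    IdentDistrib (fun ω => (X i ω, Y i ω)) (fun ω => (X j ω, Y j ω)) μ μ
  symmetric : ∀ i, CondSymmetric μ (X i) (ε i)
  subgaussian : ∀ i, CondSubgaussian μ (X i) (ε i) bε

/-- The sigma-algebra generated by the design `X^n = (X_1, …, X_n)`. -/
abbrev designSigma {Ω : Type*} {d n : ℕ} (X : Fin n → Ω → Cube d) : MeasurableSpace Ω :=
  MeasurableSpace.comap (fun ω i => X i ω) inferInstance

/-- The empirical risk `R_n(f) = n⁻¹ ∑ (y_i - f(x_i))²`. -/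
def empiricalRisk {d n : ℕ} (x : Fin n → Cube d) (y : Fin n → ℝ) (f : C(Cube d, ℝ)) : ℝ :=
  (1 / (n : ℝ)) * ∑ i, (y i - f (x i)) ^ 2

/-- `f` is a penalized empirical risk minimizer: it minimizes `R_n(f) + h² |f|_F^α` over `F`. -/
def IsPERM {d n : ℕ} (F : Submodule ℝ C(Cube d, ℝ)) (p : Seminorm ℝ F) (h α : ℝ)
    (x : Fin n → Cube d) (y : Fin n → ℝ) (f : F) : Prop :=
  ∀ g : F, empiricalRisk x y (f : C(Cube d, ℝ)) + h ^ 2 * p f ^ α ≤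
    empiricalRisk x y (g : C(Cube d, ℝ)) + h ^ 2 * p g ^ α

/-- The squared empirical norm `‖g‖_n² = n⁻¹ ∑ g(x_i)²`. -/
def empiricalNormSq {d n : ℕ} (x : Fin n → Cube d) (g : C(Cube d, ℝ)) : ℝ :=
  (1 / (n : ℝ)) * ∑ i, (g (x i)) ^ 2

/-- The squared norm `‖g‖² = ∫ g² dP_X`. -/
def designNormSq {d : ℕ} (PX : Measure (Cube d)) (g : C(Cube d, ℝ)) : ℝ :=
  ∫ x, (g x) ^ 2 ∂PX

/-- The random element `fbar` of `F` is a penalized least-squares estimator built on the sample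
`(X_i, Y_i)`: its values are random variables and it is almost surely a minimizer, for the smoothing
parameter `h = a n^{-1/(2+β)}`. -/
structure IsPERMEstimator {Ω : Type*} [MeasurableSpace Ω] (μ : Measure Ω) {d n : ℕ}
    (F : Submodule ℝ C(Cube d, ℝ)) (p : Seminorm ℝ F) (a β α : ℝ)
    (X : Fin n → Ω → Cube d) (Y : Fin n → Ω → ℝ) (fbar : Ω → F) : Prop where
  measurable_eval : ∀ x : Cube d, Measurable (fun ω => (fbar ω : C(Cube d, ℝ)) x)
  isPERM : ∀ᵐ ω ∂μ,
    IsPERM F p (a * (n : ℝ) ^ (-1 / (2 + β))) α (fun i => X i ω) (fun i => Y i ω) (fbar ω)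

end PERM

end

/-!
The estimator `fbar` is compared with `f₀` through the basic inequality of penalized least squares,
`‖fbar - f₀‖_n² + h² |fbar|^α ≤ 2 n^{-1/2} ξ(fbar - f₀) + h² |f₀|^α`, where
`ξ(g) = n^{-1/2} ∑ e i * g (X i)` is the noise process (`IsPERM.basic_inequality`).

The noise process is controlled uniformly over `F` by chaining along sup-norm nets of the unit ball
at the scales `2^{-k}`. The nets are deterministic, so conditionally on the design every link is a
subgaussian variable. Instead of suprema and tail bounds, one single random variable is used,
`chainSum`: the sum over all links `u` of the exponentials of the normalized noise at `u`,
discounted by the entropy of the level. The discount makes its conditional expectation given the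
design bounded (`IsSubgaussianSample.setLIntegral_chainSum_le`), and each link is at most a
logarithm of the sum. As `β < 2`, summing the links gives
`|ξ(g)| ≤ C (1 + log (1 + W)) 2^{mβ/2} (‖g‖_n + P 2^{-m})` for all `m` and all `g` with `|g| ≤ P`
(`abs_noiseSum_le_of_chainSum`). It suffices to use it at one scale, chosen according to `P`: the
one at which `n^{-1/2} 2^{mβ/2}` and `P 2^{-m}` are both of the order of
`r = n^{-1/(2+β)} P^{β/(2+β)}` (`exists_scale`). The stochastic term is then quadratic in
`‖fbar - f₀‖_n` and `r`. As `r² = n^{-2/(2+β)} P^{2β/(2+β)}` and `2β/(2+β) < α`, the power of the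
seminorm is absorbed by the penalty, and both `‖fbar - f₀‖_n²` and `n^{-2/(2+β)} |fbar|^α` are at
most a constant times `n^{-2/(2+β)} (1 + |f₀|^α + W)` (`exists_IsPERM_bound`). Taking conditional
expectations proves the bound in the empirical norm.

For the population norm, the two norms are compared on `{g | ‖g‖ ≤ Q}`. The set `{g | |g| ≤ 2^j}` is
covered at the radius which balances its entropy with `n` times the squared radius, and for each
centre the lower deviations of the empirical norm have bounded exponential moments. A discounted
sum `V` of exponentials, now over `j`, gives
`‖g‖² ≤ 8 ‖g‖_n² + C n^{-2/(2+β)} P^{2β/(2+β)} (1 + log (1 + V))` (`exists_norm_comparison`), and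
the bound on `|fbar|^α` finishes the proof. All the bounds hold for every `n ≥ 1`.
-/

namespace PERM

/-! ### Elementary inequalities -/

theorem one_add_rpow_le_exp {s : ℝ} (hs : 0 < s) {L : ℝ} (hL : 0 ≤ L) :
    (1 + L) ^ s ≤ s ^ s * Real.exp 1 * Real.exp L := by
  have h1 : (1 + L) / s ≤ Real.exp ((1 + L) / s) := by
    linarith [Real.add_one_le_exp ((1 + L) / s)]
  have h2 : 1 + L ≤ s * Real.exp ((1 + L) / s) := by
    rwa [div_le_iff₀ hs, mul_comm] at h1
  calc (1 + L) ^ s ≤ (s * Real.exp ((1 + L) / s)) ^ s :=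
        Real.rpow_le_rpow (by linarith) h2 hs.le
    _ = s ^ s * Real.exp 1 * Real.exp L := by
        rw [Real.mul_rpow hs.le (Real.exp_pos _).le, ← Real.exp_mul, div_mul_cancel₀ _ hs.ne',
          Real.exp_add, mul_assoc]

/-- A Young-type inequality: as `γ < α`, the term `x ^ γ` is absorbed by an arbitrarily small
multiple of `x ^ α`, at the price of an exponential moment of the other factor. -/
theorem exists_rpow_mul_sq_le {γ α c : ℝ} (hγ : 0 < γ) (hγα : γ < α) (hc : 0 < c) :
    ∃ C : ℝ, 0 < C ∧ ∀ x L : ℝ, 0 ≤ x → 0 ≤ L →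
      x ^ γ * (1 + L) ^ 2 ≤ c * x ^ α + C * Real.exp L := by
  have hd : 0 < α - γ := by linarith
  set s : ℝ := 2 + 2 * (γ / (α - γ)) with hs_def
  have hs : 0 < s := by positivity
  refine ⟨(1 / c) ^ (γ / (α - γ)) * (s ^ s * Real.exp 1), by positivity, fun x L hx hL => ?_⟩
  have hL1 : 0 < 1 + L := by linarith
  by_cases h : x ^ γ * (1 + L) ^ 2 ≤ c * x ^ α
  · have : 0 ≤ (1 / c) ^ (γ / (α - γ)) * (s ^ s * Real.exp 1) * Real.exp L := by positivity
    linarith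
  · have hx0 : 0 < x := by
      rcases hx.eq_or_lt with h0 | h0
      · subst h0
        simp [Real.zero_rpow hγ.ne', Real.zero_rpow (hγ.trans hγα).ne'] at h
      · exact h0
    have h1 : x ^ (α - γ) ≤ (1 + L) ^ 2 / c := by
      rw [le_div_iff₀ hc, Real.rpow_sub hx0, div_mul_eq_mul_div, div_le_iff₀ (by positivity)]
      push Not at h
      linarith
    have h2 : x ^ γ ≤ ((1 + L) ^ 2 / c) ^ (γ / (α - γ)) := by
      calc x ^ γ = (x ^ (α - γ)) ^ (γ / (α - γ)) := by
            rw [← Real.rpow_mul hx, mul_div_cancel₀ _ hd.ne']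
        _ ≤ _ := Real.rpow_le_rpow (by positivity) h1 (by positivity)
    have h3 : ((1 + L) ^ 2 / c) ^ (γ / (α - γ)) * (1 + L) ^ 2
        = (1 / c) ^ (γ / (α - γ)) * (1 + L) ^ s := by
      rw [hs_def, Real.rpow_add hL1, div_eq_mul_one_div, Real.mul_rpow (by positivity)
        (by positivity), Real.rpow_mul hL1.le, Real.rpow_two]
      ring
    have h4 := one_add_rpow_le_exp hs hL
    have : 0 ≤ c * x ^ α := by positivity
    calc x ^ γ * (1 + L) ^ 2 ≤ ((1 + L) ^ 2 / c) ^ (γ / (α - γ)) * (1 + L) ^ 2 := by gcongr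
      _ = (1 / c) ^ (γ / (α - γ)) * (1 + L) ^ s := h3
      _ ≤ (1 / c) ^ (γ / (α - γ)) * (s ^ s * Real.exp 1 * Real.exp L) := by gcongr
      _ ≤ _ := by linarith

/-- The form of `exists_rpow_mul_sq_le` in which it is used: the base is `1 + x + y`, and `L` is
the logarithm of `1 + w`. -/
theorem exists_one_add_add_rpow_mul_sq_le {γ α c : ℝ} (hγ : 0 < γ) (hγ1 : γ ≤ 1) (hγα : γ < α)
    (hc : 0 < c) :
    ∃ C : ℝ, 0 < C ∧ ∀ x y w : ℝ, 0 ≤ x → 0 ≤ y → 0 ≤ w →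
      (1 + x + y) ^ γ * (1 + Real.log (1 + w)) ^ 2 ≤ c * x ^ α + C * (1 + y ^ α + w) := by
  obtain ⟨C, hC, h⟩ := exists_rpow_mul_sq_le hγ hγα hc
  refine ⟨c + 3 * C, by positivity, fun x y w hx hy hw => ?_⟩
  have hL : 0 ≤ Real.log (1 + w) := Real.log_nonneg (by linarith)
  have hE : Real.exp (Real.log (1 + w)) = 1 + w := Real.exp_log (by linarith)
  have hx' := h x _ hx hL
  have hy' := h y _ hy hL
  have h1' := h 1 _ zero_le_one hL
  rw [hE] at hx' hy' h1'
  rw [Real.one_rpow, Real.one_rpow] at h1'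
  have hs : (1 + x + y) ^ γ ≤ 1 + x ^ γ + y ^ γ := by
    have e1 := Real.rpow_add_le_add_rpow (add_nonneg zero_le_one hx) hy hγ.le hγ1
    have e2 := Real.rpow_add_le_add_rpow zero_le_one hx hγ.le hγ1
    rw [Real.one_rpow] at e2
    linarith
  have hyα : 0 ≤ y ^ α := by positivity
  have := mul_le_mul_of_nonneg_right hs (sq_nonneg (1 + Real.log (1 + w)))
  nlinarith [mul_nonneg hC.le hyα, mul_nonneg hc.le hw]

/-- If `exp (s z - s² T)` and `exp (-s z - s² T)` are both at most `W` and `1 ≤ s`, then `|z|` is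
at most `s` times a logarithm of `W`. -/
theorem abs_le_of_exp_le {s z T W : ℝ} (hs : 1 ≤ s) (hW : 0 ≤ W)
    (h₁ : Real.exp (s * z - s ^ 2 * T) ≤ W) (h₂ : Real.exp (-(s * z) - s ^ 2 * T) ≤ W) :
    |z| ≤ s * (T + Real.log (1 + W)) := by
  have hL : 0 ≤ Real.log (1 + W) := Real.log_nonneg (by linarith)
  have key : ∀ y, Real.exp (y - s ^ 2 * T) ≤ W → y ≤ s ^ 2 * T + Real.log (1 + W) := by
    intro y hy
    have := (Real.le_log_iff_exp_le (by linarith)).2 (hy.trans (by linarith : W ≤ 1 + W))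
    linarith
  have k1 := key _ h₁
  have k2 := key _ h₂
  have hs2 : Real.log (1 + W) ≤ s ^ 2 * Real.log (1 + W) :=
    le_mul_of_one_le_left hL (one_le_pow₀ hs)
  have hs0 : 0 < s := by linarith
  rw [abs_le]
  constructor
  · by_contra! hcon
    have := mul_lt_mul_of_pos_left hcon hs0
    nlinarith
  · by_contra! hcon
    have := mul_lt_mul_of_pos_left hcon hs0
    nlinarith

/-! ### Nets from the entropy bound -/

/-- An entropy bound is a finite cover of controlled cardinality. -/
theorem exists_net_unitBall {d : ℕ} {F : Submodule ℝ C(Cube d, ℝ)} {p : Seminorm ℝ F} {D β : ℝ}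
    (hF : EntropyBound F p D β) {δ : ℝ} (hδ : 0 < δ) :
    ∃ N : Finset C(Cube d, ℝ), (N.card : ℝ) ≤ Real.exp (D * δ ^ (-β)) ∧
      ∀ g : F, p g ≤ 1 → ∃ u ∈ N, ‖(g : C(Cube d, ℝ)) - u‖ ≤ δ := by
  lift δ to ℝ≥0 using hδ.le
  have h := hF δ hδ
  set A := unitBall F p
  have h1 : ((Metric.externalCoveringNumber δ A : ℕ∞) : ℝ≥0∞)
      ≤ ENNReal.ofReal (Real.exp (D * δ ^ (-β))) := by
    rw [← ENNReal.log_le_log_iff, ENNReal.log_ofReal_of_pos (Real.exp_pos _), Real.log_exp]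
    exact h
  have hne : Metric.externalCoveringNumber δ A ≠ ⊤ := by
    intro htop
    rw [htop] at h1
    simp at h1
  obtain ⟨C, hC⟩ : ∃ C : {C : Set C(Cube d, ℝ) // Metric.IsCover δ A C},
      C.1.encard = Metric.externalCoveringNumber δ A := by
    have : Nonempty {C : Set C(Cube d, ℝ) // Metric.IsCover δ A C} := ⟨⟨A, .rfl⟩⟩
    obtain ⟨C, hC⟩ := ENat.exists_eq_iInf
      (fun C : {C : Set C(Cube d, ℝ) // Metric.IsCover δ A C} => C.1.encard)
    refine ⟨C, hC.trans ?_⟩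
    exact iInf_subtype
  have hfin : C.1.Finite := Set.encard_ne_top_iff.1 (hC ▸ hne)
  refine ⟨hfin.toFinset, ?_, fun g hg => ?_⟩
  · rw [← hC, hfin.encard_eq_coe_toFinset_card] at h1
    have h2 := ENNReal.toReal_mono ENNReal.ofReal_ne_top h1
    rwa [ENNReal.toReal_ofReal (Real.exp_pos _).le, ENat.toENNReal_coe,
      ENNReal.toReal_natCast] at h2
  · obtain ⟨u, hu, hgu⟩ := C.2 (x := (g : C(Cube d, ℝ))) ⟨g, hg, rfl⟩
    refine ⟨u, hfin.mem_toFinset.2 hu, ?_⟩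
    have hgu' : edist (g : C(Cube d, ℝ)) u ≤ (δ : ℝ≥0∞) := hgu
    rw [edist_le_coe, ← NNReal.coe_le_coe, coe_nndist, dist_eq_norm] at hgu'
    exact hgu'

/-- The cover of the ball of radius `P`, by homogeneity of the seminorm. -/
theorem exists_net_ball {d : ℕ} {F : Submodule ℝ C(Cube d, ℝ)} {p : Seminorm ℝ F} {D β : ℝ}
    (hF : EntropyBound F p D β) {δ P : ℝ} (hδ : 0 < δ) (hP : 0 < P) :
    ∃ N : Finset C(Cube d, ℝ), (N.card : ℝ) ≤ Real.exp (D * (P / δ) ^ β) ∧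
      ∀ g : F, p g ≤ P → ∃ u ∈ N, ‖(g : C(Cube d, ℝ)) - u‖ ≤ δ := by
  classical
  obtain ⟨N, hN, hcov⟩ := exists_net_unitBall hF (div_pos hδ hP)
  refine ⟨N.image (fun u => P • u), ?_, fun g hg => ?_⟩
  · refine (Nat.cast_le.2 Finset.card_image_le).trans (hN.trans (le_of_eq ?_))
    rw [Real.rpow_neg (by positivity), ← Real.inv_rpow (by positivity), inv_div]
  · obtain ⟨u, hu, hgu⟩ := hcov (P⁻¹ • g) (by
      rw [map_smul_eq_mul, Real.norm_of_nonneg (by positivity), inv_mul_le_iff₀ hP, mul_one]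
      exact hg)
    refine ⟨P • u, Finset.mem_image_of_mem _ hu, ?_⟩
    have : (g : C(Cube d, ℝ)) - P • u = P • (((P⁻¹ • g : F) : C(Cube d, ℝ)) - u) := by
      rw [smul_sub, Submodule.coe_smul, smul_inv_smul₀ hP.ne']
    rw [this, norm_smul, Real.norm_of_nonneg hP.le]
    rwa [le_div_iff₀ hP, mul_comm] at hgu

/-- The centres of the cover can be moved into the set `{g | p g ≤ P, ‖g‖ ≤ Q}` they cover, at the
price of doubling the radius. -/
theorem exists_net_ball_inter {d : ℕ} {F : Submodule ℝ C(Cube d, ℝ)} {p : Seminorm ℝ F} {D β : ℝ}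
    (hF : EntropyBound F p D β) {δ P : ℝ} (hδ : 0 < δ) (hP : 0 < P) (Q : ℝ) :
    ∃ N : Finset C(Cube d, ℝ), (N.card : ℝ) ≤ Real.exp (D * (P / δ) ^ β) ∧
      (∀ u ∈ N, ‖u‖ ≤ Q) ∧
      ∀ g : F, p g ≤ P → ‖(g : C(Cube d, ℝ))‖ ≤ Q → ∃ u ∈ N, ‖(g : C(Cube d, ℝ)) - u‖ ≤ 2 * δ := by
  classical
  obtain ⟨N, hN, hcov⟩ := exists_net_ball hF hδ hP
  let near : C(Cube d, ℝ) → C(Cube d, ℝ) → Prop := fun u v => ‖v‖ ≤ Q ∧ ‖v - u‖ ≤ δ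
  let rep : C(Cube d, ℝ) → C(Cube d, ℝ) := fun u => if h : ∃ v, near u v then h.choose else 0
  -- centres far from the set are discarded; each other one is replaced by a nearby point of the set
  refine ⟨(N.filter fun u => ∃ v, near u v).image rep, ?_, ?_, fun g hg hgQ => ?_⟩
  · exact (Nat.cast_le.2 (Finset.card_image_le.trans (Finset.card_filter_le _ _))).trans hN
  · intro w hw
    obtain ⟨u, hu, rfl⟩ := Finset.mem_image.1 hw
    have h := (Finset.mem_filter.1 hu).2
    simp only [rep, dif_pos h]
    exact h.choose_spec.1
  · obtain ⟨u, hu, hgu⟩ := hcov g hg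
    have h : ∃ v, near u v := ⟨g, hgQ, hgu⟩
    refine ⟨rep u, Finset.mem_image_of_mem _ (Finset.mem_filter.2 ⟨hu, h⟩), ?_⟩
    simp only [rep, dif_pos h]
    have h2 := h.choose_spec.2
    have h3 := norm_sub_le_norm_sub_add_norm_sub (g : C(Cube d, ℝ)) u h.choose
    rw [norm_sub_rev] at h2
    linarith

/-! ### Exponential moments of conditionally subgaussian variables -/

/-- The joint law `ν` of a pair `(X, e)` is conditionally subgaussian when
`E[exp(t e); X ∈ B] ≤ exp(b² t² / 2) P(X ∈ B)` for every real `t` and measurable `B`. This is the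
integrated form of the conditional bound, for both signs of `t`. -/
def IsCondSubgaussianLaw {S : Type*} [MeasurableSpace S] (ν : Measure (S × ℝ)) (b : ℝ) : Prop :=
  ∀ (t : ℝ) (B : Set S), MeasurableSet B →
    ∫⁻ z in Prod.fst ⁻¹' B, ENNReal.ofReal (Real.exp (t * z.2)) ∂ν
      ≤ ENNReal.ofReal (Real.exp (b ^ 2 * t ^ 2 / 2)) * ν (Prod.fst ⁻¹' B)

/-- The disintegrated form of the bound, with an exceptional set that does not depend on `t`. -/
theorem IsCondSubgaussianLaw.ae_condKernel {S : Type*} [MeasurableSpace S] {ν : Measure (S × ℝ)}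
    [IsFiniteMeasure ν] {b : ℝ} (h : IsCondSubgaussianLaw ν b) :
    ∀ᵐ x ∂ν.fst, ∀ t : ℝ, ∫⁻ e, ENNReal.ofReal (Real.exp (t * e)) ∂(ν.condKernel x)
      ≤ ENNReal.ofReal (Real.exp (b ^ 2 * t ^ 2 / 2)) := by
  have hrat : ∀ᵐ x ∂ν.fst, ∀ t : ℚ, ∫⁻ e, ENNReal.ofReal (Real.exp (t * e)) ∂(ν.condKernel x)
      ≤ ENNReal.ofReal (Real.exp (b ^ 2 * (t : ℝ) ^ 2 / 2)) := by
    rw [ae_all_iff]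
    intro t
    have hm : Measurable (fun z : S × ℝ => ENNReal.ofReal (Real.exp ((t : ℝ) * z.2))) := by
      fun_prop
    refine ae_le_of_forall_setLIntegral_le_of_sigmaFinite
      (Measurable.lintegral_kernel (by fun_prop)) fun B hB _ => ?_
    have h1 := h t B hB
    rw [setLIntegral_const, Measure.fst_apply hB]
    refine le_trans (le_of_eq ?_) h1
    have h2 := Measure.setLIntegral_compProd (μ := ν.fst) (κ := ν.condKernel) hm hB
      MeasurableSet.univ
    rw [ν.disintegrate ν.condKernel] at h2
    simp only [Measure.restrict_univ] at h2
    rw [← h2, ← Set.prod_univ]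
  filter_upwards [hrat] with x hx t
  -- Fatou's lemma along rationals converging to `t`
  obtain ⟨u, hu⟩ : ∃ u : ℕ → ℚ, Filter.Tendsto (fun n => (u n : ℝ)) Filter.atTop (nhds t) := by
    obtain ⟨u, -, -, hu⟩ :=
      (Rat.denseRange_cast (𝕜 := ℝ)).exists_seq_strictMono_tendsto Rat.cast_mono t
    exact ⟨u, hu⟩
  have hcont : Continuous fun s : ℝ => ENNReal.ofReal (Real.exp (b ^ 2 * s ^ 2 / 2)) :=
    ENNReal.continuous_ofReal.comp (by fun_prop)
  have hlim := (hcont.tendsto t).comp hu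
  calc ∫⁻ e, ENNReal.ofReal (Real.exp (t * e)) ∂(ν.condKernel x)
      = ∫⁻ e, Filter.liminf (fun n => ENNReal.ofReal (Real.exp (u n * e))) Filter.atTop
          ∂(ν.condKernel x) := by
        refine lintegral_congr fun e => ?_
        have hc : Continuous fun s : ℝ => ENNReal.ofReal (Real.exp (s * e)) :=
          ENNReal.continuous_ofReal.comp (by fun_prop)
        exact (((hc.tendsto t).comp hu).liminf_eq).symm
    _ ≤ Filter.liminf (fun n => ∫⁻ e, ENNReal.ofReal (Real.exp (u n * e)) ∂(ν.condKernel x))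
          Filter.atTop := lintegral_liminf_le fun n => by fun_prop
    _ ≤ Filter.liminf (fun n => ENNReal.ofReal (Real.exp (b ^ 2 * (u n : ℝ) ^ 2 / 2)))
          Filter.atTop := Filter.liminf_le_liminf (.of_forall fun n => hx (u n))
    _ = _ := hlim.liminf_eq

/-- The exponential bound with a multiplier `τ` depending on the design point. -/
theorem IsCondSubgaussianLaw.lintegral_le {S : Type*} [MeasurableSpace S] {ν : Measure (S × ℝ)}
    [IsFiniteMeasure ν] {b : ℝ} (h : IsCondSubgaussianLaw ν b) {H : S → ℝ≥0∞} {τ : S → ℝ}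
    (hH : Measurable H) (hτ : Measurable τ) :
    ∫⁻ z, H z.1 * ENNReal.ofReal (Real.exp (τ z.1 * z.2 - b ^ 2 * τ z.1 ^ 2 / 2)) ∂ν
      ≤ ∫⁻ z, H z.1 ∂ν := by
  have e1 : ∫⁻ z, H z.1 ∂ν = ∫⁻ x, H x ∂ν.fst := by
    rw [Measure.fst, lintegral_map hH measurable_fst]
  rw [e1]
  conv_lhs => rw [← ν.disintegrate ν.condKernel]
  rw [Measure.lintegral_compProd (by fun_prop)]
  refine lintegral_mono_ae ?_
  filter_upwards [h.ae_condKernel] with x hx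
  have hexp : ∀ e : ℝ, ENNReal.ofReal (Real.exp (τ x * e - b ^ 2 * τ x ^ 2 / 2))
      = ENNReal.ofReal (Real.exp (-(b ^ 2 * τ x ^ 2 / 2))) *
        ENNReal.ofReal (Real.exp (τ x * e)) := by
    intro e
    rw [← ENNReal.ofReal_mul (Real.exp_pos _).le, ← Real.exp_add]
    congr 2; ring
  simp only [hexp]
  rw [lintegral_const_mul _ (by fun_prop), lintegral_const_mul _ (by fun_prop)]
  refine mul_le_of_le_one_right' ?_
  refine (mul_le_mul_right (hx (τ x)) _).trans (le_of_eq ?_)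
  rw [← ENNReal.ofReal_mul (Real.exp_pos _).le, ← Real.exp_add]
  simp

/-- For independent pairs `(x i, e i)` and multipliers that depend on the whole design, the
exponentials of `τ i (x) * e i` are integrated out one coordinate at a time. -/
theorem lintegral_pi_prod_exp_le {ι S : Type*} [Fintype ι] [DecidableEq ι] [MeasurableSpace S]
    {ν : ι → Measure (S × ℝ)} [∀ i, IsProbabilityMeasure (ν i)] {b : ℝ}
    (h : ∀ i, IsCondSubgaussianLaw (ν i) b) {H : (ι → S) → ℝ≥0∞} {τ : ι → (ι → S) → ℝ}
    (hH : Measurable H) (hτ : ∀ i, Measurable (τ i)) (s : Finset ι) :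
    ∫⁻ z, H (fun i => (z i).1) * ∏ i ∈ s, ENNReal.ofReal (Real.exp
        (τ i (fun i => (z i).1) * (z i).2 - b ^ 2 * τ i (fun i => (z i).1) ^ 2 / 2))
        ∂Measure.pi ν
      ≤ ∫⁻ z, H (fun i => (z i).1) ∂Measure.pi ν := by
  have hmeas : ∀ s : Finset ι, Measurable fun z : ι → S × ℝ =>
      H (fun i => (z i).1) * ∏ i ∈ s, ENNReal.ofReal (Real.exp
        (τ i (fun i => (z i).1) * (z i).2 - b ^ 2 * τ i (fun i => (z i).1) ^ 2 / 2)) := by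
    intro s
    have hx : Measurable fun (z : ι → S × ℝ) i => (z i).1 := by fun_prop
    refine (hH.comp hx).mul (Finset.measurable_fun_prod _ fun i _ => ?_)
    have := (hτ i).comp hx
    fun_prop
  induction s using Finset.induction_on with
  | empty => simp
  | insert j s hj ih =>
    refine le_trans ?_ ih
    refine lintegral_le_of_lmarginal_le {j} (hmeas _) (hmeas _) ?_
    rw [lmarginal_singleton, lmarginal_singleton]
    intro z
    have hfst : ∀ w : S × ℝ, (fun i => (Function.update z j w i).1)
        = Function.update (fun i => (z i).1) j w.1 := by
      intro w
      ext i
      by_cases hij : i = j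
      · subst hij; simp
      · simp [hij]
    have hupd : Measurable fun y : S => Function.update (fun i => (z i).1) j y :=
      measurable_update _
    set K : S → ℝ≥0∞ := fun y => H (Function.update (fun i => (z i).1) j y) *
      ∏ i ∈ s, ENNReal.ofReal (Real.exp
        (τ i (Function.update (fun i => (z i).1) j y) * (z i).2
          - b ^ 2 * τ i (Function.update (fun i => (z i).1) j y) ^ 2 / 2)) with hK
    have hKm : Measurable K := by
      refine (hH.comp hupd).mul (Finset.measurable_fun_prod _ fun i _ => ?_)
      have := (hτ i).comp hupd
      fun_prop
    have hprod : ∀ w : S × ℝ, ∏ i ∈ s, ENNReal.ofReal (Real.exp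
        (τ i (Function.update (fun i => (z i).1) j w.1) * (Function.update z j w i).2
          - b ^ 2 * τ i (Function.update (fun i => (z i).1) j w.1) ^ 2 / 2))
        = ∏ i ∈ s, ENNReal.ofReal (Real.exp
        (τ i (Function.update (fun i => (z i).1) j w.1) * (z i).2
          - b ^ 2 * τ i (Function.update (fun i => (z i).1) j w.1) ^ 2 / 2)) := by
      intro w
      refine Finset.prod_congr rfl fun i hi => ?_
      have hij : i ≠ j := fun hij => hj (hij ▸ hi)
      rw [Function.update_of_ne hij]
    have := (h j).lintegral_le hKm ((hτ j).comp hupd)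
    simp only [hfst, Finset.prod_insert hj, hprod, Function.update_self]
    refine le_trans (le_of_eq (lintegral_congr fun w => ?_)) this
    simp only [hK, Function.comp]
    ring

/-- The symmetry of the noise extends the subgaussian bound from positive to negative `t`. -/
theorem isCondSubgaussianLaw_map {Ω S : Type*} [MeasurableSpace Ω] [MeasurableSpace S]
    {μ : Measure Ω} [IsProbabilityMeasure μ] {X : Ω → S} {ε : Ω → ℝ} {b σ : ℝ}
    (hX : Measurable X) (hε : Measurable ε) (hsym : CondSymmetric μ X ε)
    (hsub : CondSubgaussian μ X ε b) :
    IsCondSubgaussianLaw (μ.map fun ω => (X ω, σ * ε ω)) (σ * b) := by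
  have hpair : Measurable fun ω => (X ω, σ * ε ω) := by fun_prop
  have hpos : ∀ (t : ℝ) (B : Set S), 0 < t → MeasurableSet B →
      ∫⁻ ω in X ⁻¹' B, ENNReal.ofReal (Real.exp (t * ε ω)) ∂μ
        ≤ ENNReal.ofReal (Real.exp (b ^ 2 * t ^ 2 / 2)) * μ (X ⁻¹' B) := by
    intro t B ht hB
    obtain ⟨hint, hle⟩ := hsub t ht
    have hm : MeasurableSpace.comap X inferInstance ≤ (inferInstance : MeasurableSpace Ω) :=
      hX.comap_le
    rw [← ofReal_integral_eq_lintegral_ofReal hint.integrableOn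
      (.of_forall fun ω => (Real.exp_pos _).le), ← setIntegral_condExp hm hint ⟨B, hB, rfl⟩]
    have h1 := setIntegral_mono_ae (μ := μ) (s := X ⁻¹' B) integrable_condExp.integrableOn
      (integrable_const _).integrableOn hle
    rw [setIntegral_const, smul_eq_mul, mul_comm] at h1
    refine (ENNReal.ofReal_le_ofReal h1).trans (le_of_eq ?_)
    rw [ENNReal.ofReal_mul (Real.exp_pos _).le, ofReal_measureReal]
  have hneg : ∀ (t : ℝ) (B : Set S), MeasurableSet B →
      ∫⁻ ω in X ⁻¹' B, ENNReal.ofReal (Real.exp (-t * ε ω)) ∂μ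
        = ∫⁻ ω in X ⁻¹' B, ENNReal.ofReal (Real.exp (t * ε ω)) ∂μ := by
    intro t B hB
    have key : ∀ ε' : Ω → ℝ, Measurable ε' →
        ∫⁻ ω in X ⁻¹' B, ENNReal.ofReal (Real.exp (t * ε' ω)) ∂μ
        = ∫⁻ z in Prod.fst ⁻¹' B, ENNReal.ofReal (Real.exp (t * z.2))
            ∂(μ.map fun ω => (X ω, ε' ω)) := by
      intro ε' hε'
      rw [setLIntegral_map (measurable_fst hB) (by fun_prop) (by fun_prop)]
      rfl
    have h1 := key ε hε
    have h2 := key (fun ω => -ε ω) hε.neg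
    rw [h1, hsym.map_eq, ← h2]
    simp
  intro t B hB
  rw [setLIntegral_map (measurable_fst hB) (by fun_prop) hpair,
    Measure.map_apply hpair (measurable_fst hB)]
  have e1 : (fun ω => (X ω, σ * ε ω)) ⁻¹' (Prod.fst ⁻¹' B) = X ⁻¹' B := rfl
  rw [e1]
  simp only [← mul_assoc]
  have e2 : (σ * b) ^ 2 * t ^ 2 / 2 = b ^ 2 * (t * σ) ^ 2 / 2 := by ring
  rw [e2]
  rcases lt_trichotomy (t * σ) 0 with ht | ht | ht
  · have := hpos (-(t * σ)) B (by linarith) hB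
    rw [← hneg (t * σ) B hB]
    simpa using this
  · simp [ht]
  · exact hpos _ B ht hB

/-- An independent sample of pairs `(X i, e i)` whose second components are subgaussian with
constant `b` conditionally on the first. -/
structure IsSubgaussianSample {Ω S : Type*} [MeasurableSpace Ω] [MeasurableSpace S]
    (μ : Measure Ω) {n : ℕ} (X : Fin n → Ω → S) (e : Fin n → Ω → ℝ) (b : ℝ) : Prop where
  measurable_X : ∀ i, Measurable (X i)
  measurable_noise : ∀ i, Measurable (e i)
  indep : iIndepFun (fun i ω => (X i ω, e i ω)) μ
  law : ∀ i, IsCondSubgaussianLaw (μ.map fun ω => (X i ω, e i ω)) b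

theorem IsRegressionSample.isSubgaussianSample {Ω : Type*} [MeasurableSpace Ω] {μ : Measure Ω}
    [IsProbabilityMeasure μ] {d n : ℕ} {PX : Measure (Cube d)} {f₀ : C(Cube d, ℝ)} {σ bε : ℝ}
    {X : Fin n → Ω → Cube d} {ε Y : Fin n → Ω → ℝ}
    (h : IsRegressionSample μ PX f₀ σ bε X ε Y) :
    IsSubgaussianSample μ X (fun i ω => Y i ω - f₀ (X i ω)) (σ * bε) := by
  have he : (fun i ω => Y i ω - f₀ (X i ω)) = fun i ω => σ * ε i ω := by
    funext i ω
    rw [h.model]; ring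
  refine ⟨h.measurable_X, fun i => ?_, ?_, fun i => ?_⟩
  · rw [congrFun he i]
    exact (h.measurable_noise i).const_mul σ
  · exact h.indep.comp (fun _ z => (z.1, z.2 - f₀ z.1)) fun i => by fun_prop
  · have := isCondSubgaussianLaw_map (σ := σ) (h.measurable_X i) (h.measurable_noise i)
      (h.symmetric i) (h.subgaussian i)
    simpa only [congrFun (congrFun he i) _] using this

/-- A linear combination of the noise whose coefficients are functions of the design, with sum of
squares at most `V`, is subgaussian conditionally on the design. -/
theorem IsSubgaussianSample.setLIntegral_exp_le {Ω S : Type*} [MeasurableSpace Ω]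
    [MeasurableSpace S] {μ : Measure Ω} [IsProbabilityMeasure μ] {n : ℕ} {X : Fin n → Ω → S}
    {e : Fin n → Ω → ℝ} {b : ℝ} (h : IsSubgaussianSample μ X e b) {A : Set (Fin n → S)}
    (hA : MeasurableSet A) {τ : Fin n → (Fin n → S) → ℝ} (hτ : ∀ i, Measurable (τ i)) {V : ℝ}
    (hV : ∀ x, ∑ i, τ i x ^ 2 ≤ V) :
    ∫⁻ ω in (fun ω i => X i ω) ⁻¹' A,
        ENNReal.ofReal (Real.exp (∑ i, τ i (fun i => X i ω) * e i ω)) ∂μ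
      ≤ ENNReal.ofReal (Real.exp (b ^ 2 * V / 2)) * μ ((fun ω i => X i ω) ⁻¹' A) := by
  classical
  have hX := h.measurable_X
  have he := h.measurable_noise
  have hXm : Measurable fun ω i => X i ω := measurable_pi_lambda _ hX
  have hpair : ∀ i, Measurable fun ω => (X i ω, e i ω) := fun i => (hX i).prodMk (he i)
  have hall : Measurable fun ω i => (X i ω, e i ω) := measurable_pi_lambda _ hpair
  have hprob : ∀ i, IsProbabilityMeasure (μ.map fun ω => (X i ω, e i ω)) := fun i =>
    Measure.isProbabilityMeasure_map (hpair i).aemeasurable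
  have hmap := (iIndepFun_iff_map_fun_eq_pi_map fun i => (hpair i).aemeasurable).1 h.indep
  have key := lintegral_pi_prod_exp_le h.law
    (H := A.indicator fun _ => 1) (measurable_const.indicator hA) hτ Finset.univ
  have hfst : Measurable fun (z : Fin n → S × ℝ) i => (z i).1 := by fun_prop
  have hH : Measurable fun z : Fin n → S × ℝ =>
      A.indicator (fun _ => (1 : ℝ≥0∞)) (fun i => (z i).1) :=
    (measurable_const.indicator hA).comp hfst
  have hP : Measurable fun z : Fin n → S × ℝ => ∏ i, ENNReal.ofReal (Real.exp
      (τ i (fun i => (z i).1) * (z i).2 - b ^ 2 * τ i (fun i => (z i).1) ^ 2 / 2)) := by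
    refine Finset.measurable_fun_prod _ fun i _ => ?_
    have := (hτ i).comp hfst
    fun_prop
  have hHP : Measurable fun z : Fin n → S × ℝ =>
      A.indicator (fun _ => (1 : ℝ≥0∞)) (fun i => (z i).1) * ∏ i, ENNReal.ofReal (Real.exp
      (τ i (fun i => (z i).1) * (z i).2 - b ^ 2 * τ i (fun i => (z i).1) ^ 2 / 2)) := hH.mul hP
  rw [← hmap, lintegral_map hHP hall, lintegral_map hH hall] at key
  have e1 : ∀ ω, A.indicator (fun _ => (1 : ℝ≥0∞)) (fun i => X i ω)
      = ((fun ω i => X i ω) ⁻¹' A).indicator (fun _ => 1) ω := fun ω => rfl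
  simp only [e1] at key
  rw [lintegral_indicator_const (hXm hA), one_mul] at key
  have hPω : Measurable fun ω => ∏ i, ENNReal.ofReal (Real.exp
      (τ i (fun i => X i ω) * e i ω - b ^ 2 * τ i (fun i => X i ω) ^ 2 / 2)) := by
    refine Finset.measurable_fun_prod _ fun i _ => ?_
    have := (hτ i).comp hXm
    have := he i
    fun_prop
  have step : ∀ ω, ENNReal.ofReal (Real.exp (∑ i, τ i (fun i => X i ω) * e i ω))
      ≤ ENNReal.ofReal (Real.exp (b ^ 2 * V / 2)) *
          ∏ i, ENNReal.ofReal (Real.exp (τ i (fun i => X i ω) * e i ω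
            - b ^ 2 * τ i (fun i => X i ω) ^ 2 / 2)) := by
    intro ω
    rw [← ENNReal.ofReal_prod_of_nonneg fun i _ => (Real.exp_pos _).le, ← Real.exp_sum,
      ← ENNReal.ofReal_mul (Real.exp_pos _).le, ← Real.exp_add]
    refine ENNReal.ofReal_le_ofReal (Real.exp_le_exp.2 ?_)
    rw [Finset.sum_sub_distrib, ← Finset.sum_div, ← Finset.mul_sum]
    nlinarith [mul_le_mul_of_nonneg_left (hV fun i => X i ω) (sq_nonneg b)]
  refine (lintegral_mono step).trans ?_
  rw [lintegral_const_mul _ hPω]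
  refine mul_le_mul_right (le_trans (le_of_eq ?_) key) _
  rw [← lintegral_indicator (hXm hA)]
  refine lintegral_congr fun ω => ?_
  by_cases hω : ω ∈ (fun ω i => X i ω) ⁻¹' A
  · simp only [Set.indicator_of_mem hω, one_mul]
  · simp only [Set.indicator_of_notMem hω, zero_mul]

/-! ### Chaining for the noise process -/

/-- The normalized noise process `n^{-1/2} ∑ e i * g (x i)`. -/
noncomputable def noiseSum {d n : ℕ} (x : Fin n → Cube d) (e : Fin n → ℝ)
    (g : C(Cube d, ℝ)) : ℝ :=
  (√(n : ℝ))⁻¹ * ∑ i, e i * g (x i)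

section Elementary

variable {d n : ℕ} (x : Fin n → Cube d) (e : Fin n → ℝ)

theorem noiseSum_sub (g u : C(Cube d, ℝ)) :
    noiseSum x e (g - u) = noiseSum x e g - noiseSum x e u := by
  simp [noiseSum, mul_sub, Finset.sum_sub_distrib]

theorem noiseSum_smul (c : ℝ) (g : C(Cube d, ℝ)) :
    noiseSum x e (c • g) = c * noiseSum x e g := by
  simp only [noiseSum, ContinuousMap.smul_apply, smul_eq_mul, Finset.mul_sum]
  exact Finset.sum_congr rfl fun i _ => by ring

theorem abs_noiseSum_le (g : C(Cube d, ℝ)) :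
    |noiseSum x e g| ≤ ((√(n : ℝ))⁻¹ * ∑ i, |e i|) * ‖g‖ := by
  rw [noiseSum, abs_mul, abs_of_nonneg (by positivity : 0 ≤ (√(n : ℝ))⁻¹), mul_assoc,
    Finset.sum_mul]
  gcongr
  refine (Finset.abs_sum_le_sum_abs _ _).trans (Finset.sum_le_sum fun i _ => ?_)
  rw [abs_mul]
  gcongr
  exact g.norm_coe_le_norm (x i)

theorem empiricalNormSq_nonneg (g : C(Cube d, ℝ)) : 0 ≤ empiricalNormSq x g := by
  unfold empiricalNormSq
  positivity

theorem empiricalNormSq_smul (c : ℝ) (g : C(Cube d, ℝ)) :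
    empiricalNormSq x (c • g) = c ^ 2 * empiricalNormSq x g := by
  simp only [empiricalNormSq, ContinuousMap.smul_apply, smul_eq_mul, Finset.mul_sum]
  exact Finset.sum_congr rfl fun i _ => by ring

theorem empiricalNormSq_le_of_norm_le {g : C(Cube d, ℝ)} {δ : ℝ} (h : ‖g‖ ≤ δ) :
    empiricalNormSq x g ≤ δ ^ 2 := by
  unfold empiricalNormSq
  rcases Nat.eq_zero_or_pos n with rfl | hn
  · simpa using sq_nonneg δ
  have hn' : (0 : ℝ) < n := by exact_mod_cast hn
  have : ∑ i, g (x i) ^ 2 ≤ ∑ _i : Fin n, δ ^ 2 :=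
    Finset.sum_le_sum fun i _ => sq_le_sq.2
      (((g.norm_coe_le_norm (x i)).trans h).trans (le_abs_self δ))
  rw [Finset.sum_const, Finset.card_univ, Fintype.card_fin, nsmul_eq_mul] at this
  rw [one_div, inv_mul_le_iff₀ hn']
  exact this

theorem empiricalNormSq_le_two_mul (g u : C(Cube d, ℝ)) :
    empiricalNormSq x u ≤ 2 * empiricalNormSq x g + 2 * empiricalNormSq x (g - u) := by
  simp only [empiricalNormSq, ContinuousMap.sub_apply]
  have : ∑ i, u (x i) ^ 2 ≤ 2 * ∑ i, g (x i) ^ 2 + 2 * ∑ i, (g (x i) - u (x i)) ^ 2 := by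
    rw [Finset.mul_sum, Finset.mul_sum, ← Finset.sum_add_distrib]
    exact Finset.sum_le_sum fun i _ => by nlinarith [sq_nonneg (2 * g (x i) - u (x i))]
  have hn : (0 : ℝ) ≤ 1 / (n : ℝ) := by positivity
  nlinarith [mul_le_mul_of_nonneg_left this hn]

end Elementary

/-- The functions at level `k` of the chaining: the net `N k` itself, in which a chain starts, and
the differences between points of consecutive nets. -/
noncomputable def links {d : ℕ} (N : ℕ → Finset C(Cube d, ℝ)) (k : ℕ) : Finset C(Cube d, ℝ) := by
  classical
  exact N k ∪ Finset.image₂ (fun u v => v - u) (N k) (N (k + 1))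

theorem mem_links_of_mem {d : ℕ} {N : ℕ → Finset C(Cube d, ℝ)} {k : ℕ} {u : C(Cube d, ℝ)}
    (hu : u ∈ N k) : u ∈ links N k := by
  classical
  exact Finset.mem_union_left _ hu

theorem sub_mem_links {d : ℕ} {N : ℕ → Finset C(Cube d, ℝ)} {k : ℕ} {u v : C(Cube d, ℝ)}
    (hu : u ∈ N k) (hv : v ∈ N (k + 1)) : v - u ∈ links N k := by
  classical
  exact Finset.mem_union_right _ (Finset.mem_image₂_of_mem hu hv)

/-- The cardinality of the links, for nets whose entropy at level `k` is `D (q ^ k) ^ 2`. -/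
theorem card_links_le {d : ℕ} {N : ℕ → Finset C(Cube d, ℝ)} {D q : ℝ} (hD : 0 ≤ D)
    (hq0 : 0 ≤ q) (hq : q ≤ 2) (hN : ∀ k, ((N k).card : ℝ) ≤ Real.exp (D * (q ^ k) ^ 2)) (k : ℕ) :
    ((links N k).card : ℝ) ≤ 2 * Real.exp (5 * D * (q ^ k) ^ 2) := by
  classical
  have h1 : ((links N k).card : ℝ) ≤ (N k).card + (N k).card * (N (k + 1)).card := by
    have := (Finset.card_union_le (N k) (Finset.image₂ (fun u v => v - u) (N k) (N (k + 1)))).trans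
      (Nat.add_le_add_left (Finset.card_image₂_le _ _ _) _)
    exact_mod_cast this
  have h2 : (q ^ (k + 1)) ^ 2 ≤ 4 * (q ^ k) ^ 2 := by
    have : q ^ 2 ≤ 4 := by nlinarith
    rw [pow_succ q k, mul_pow, mul_comm]
    gcongr
  have hs : 0 ≤ D * (q ^ k) ^ 2 := by positivity
  have h3 : ((N (k + 1)).card : ℝ) ≤ Real.exp (4 * D * (q ^ k) ^ 2) :=
    (hN (k + 1)).trans (Real.exp_le_exp.2 (by nlinarith))
  calc ((links N k).card : ℝ) ≤ (N k).card + (N k).card * (N (k + 1)).card := h1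
    _ ≤ Real.exp (D * (q ^ k) ^ 2)
        + Real.exp (D * (q ^ k) ^ 2) * Real.exp (4 * D * (q ^ k) ^ 2) := by
        gcongr <;> exact hN k
    _ ≤ Real.exp (5 * D * (q ^ k) ^ 2) + Real.exp (5 * D * (q ^ k) ^ 2) := by
        rw [← Real.exp_add]
        gcongr <;> linarith
    _ = _ := by ring

/-- The value of the noise process at `u`, normalized by the empirical norm of `u` regularized at
scale `2^{-k}`. -/
noncomputable def linkRatio {d n : ℕ} (k : ℕ) (u : C(Cube d, ℝ)) (x : Fin n → Cube d)
    (e : Fin n → ℝ) : ℝ :=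
  noiseSum x e u / √(empiricalNormSq x u + ((1 / 2 : ℝ) ^ k) ^ 2)

/-- The sum, over all links of the chaining, of the exponentials of the normalized noise, each
discounted by the cardinality of its level. It controls all the links simultaneously and has a
bounded conditional expectation given the design. The value is `⊤` when the series diverges. -/
noncomputable def chainSum {d n : ℕ} (q T : ℝ) (N : ℕ → Finset C(Cube d, ℝ))
    (x : Fin n → Cube d) (e : Fin n → ℝ) : ℝ≥0∞ :=
  ∑' k : ℕ, ∑ u ∈ links N k,
    (ENNReal.ofReal (Real.exp (q ^ k * linkRatio k u x e - (q ^ k) ^ 2 * T)) +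
      ENNReal.ofReal (Real.exp (-(q ^ k * linkRatio k u x e) - (q ^ k) ^ 2 * T)))

theorem abs_noiseSum_le_of_mem_links {d n : ℕ} {q T : ℝ} (hq : 1 ≤ q)
    {N : ℕ → Finset C(Cube d, ℝ)} {x : Fin n → Cube d} {e : Fin n → ℝ}
    (hW : chainSum q T N x e ≠ ⊤) {k : ℕ} {u : C(Cube d, ℝ)} (hu : u ∈ links N k) :
    |noiseSum x e u| ≤ (T + Real.log (1 + (chainSum q T N x e).toReal)) *
      (q ^ k * √(empiricalNormSq x u + ((1 / 2 : ℝ) ^ k) ^ 2)) := by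
  have h0 : ENNReal.ofReal (Real.exp (q ^ k * linkRatio k u x e - (q ^ k) ^ 2 * T)) +
      ENNReal.ofReal (Real.exp (-(q ^ k * linkRatio k u x e) - (q ^ k) ^ 2 * T))
      ≤ chainSum q T N x e :=
    (Finset.single_le_sum (f := fun u => ENNReal.ofReal (Real.exp (q ^ k * linkRatio k u x e -
      (q ^ k) ^ 2 * T)) + ENNReal.ofReal (Real.exp (-(q ^ k * linkRatio k u x e) -
      (q ^ k) ^ 2 * T))) (fun _ _ => zero_le) hu).trans (ENNReal.le_tsum k)
  have hle := abs_le_of_exp_le (one_le_pow₀ hq) ENNReal.toReal_nonneg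
    ((ENNReal.ofReal_le_iff_le_toReal hW).1 (le_self_add.trans h0))
    ((ENNReal.ofReal_le_iff_le_toReal hW).1 (le_add_self.trans h0))
  have hpos : 0 < √(empiricalNormSq x u + ((1 / 2 : ℝ) ^ k) ^ 2) :=
    Real.sqrt_pos.2 (add_pos_of_nonneg_of_pos (empiricalNormSq_nonneg x u) (by positivity))
  rw [linkRatio, abs_div, abs_of_pos hpos, div_le_iff₀ hpos] at hle
  linarith

/-- Summing along the chain `u m, u (m + 1), …` towards `g`, for a noise process which is controlled
on the links. As `q < 2`, the series of the contributions `q ^ k * 2 ^ (-k)` is geometric. -/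
theorem abs_noiseSum_le_of_chain {d n : ℕ} {q Z : ℝ} (hq0 : 0 < q) (hq : q < 2) (hZ : 0 ≤ Z)
    {x : Fin n → Cube d} {e : Fin n → ℝ} {N : ℕ → Finset C(Cube d, ℝ)}
    (hlink : ∀ k, ∀ u ∈ links N k,
      |noiseSum x e u| ≤ Z * (q ^ k * √(empiricalNormSq x u + ((1 / 2 : ℝ) ^ k) ^ 2)))
    {g : C(Cube d, ℝ)} (hg : ∀ k, ∃ u ∈ N k, ‖g - u‖ ≤ (1 / 2 : ℝ) ^ k) (m : ℕ) :
    |noiseSum x e g| ≤ (2 + 2 / (1 - q / 2)) * Z * q ^ m *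
      (√(empiricalNormSq x g) + (1 / 2 : ℝ) ^ m) := by
  choose u hu hgu using hg
  set G := √(empiricalNormSq x g) with hG_def
  have hG : 0 ≤ G := Real.sqrt_nonneg _
  have hG2 : G ^ 2 = empiricalNormSq x g := Real.sq_sqrt (empiricalNormSq_nonneg x g)
  set r : ℝ := q / 2 with hr
  have hr1 : 0 < 1 - r := by rw [hr]; linarith
  have hrk : ∀ k, q ^ k * (1 / 2 : ℝ) ^ k = r ^ k := fun k => by rw [← mul_pow, hr]; congr 1; ring
  have hstart : |noiseSum x e (u m)| ≤ Z * (q ^ m * (2 * G + 2 * (1 / 2 : ℝ) ^ m)) := by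
    refine (hlink m _ (mem_links_of_mem (hu m))).trans ?_
    gcongr
    have hδ : (0 : ℝ) ≤ (1 / 2 : ℝ) ^ m := by positivity
    have h1 := empiricalNormSq_le_two_mul x g (u m)
    have h2 := empiricalNormSq_le_of_norm_le x (hgu m)
    exact Real.sqrt_le_iff.2 ⟨by positivity, by nlinarith [mul_nonneg hG hδ]⟩
  have hstep : ∀ k, |noiseSum x e (u (k + 1) - u k)| ≤ 2 * Z * r ^ k := by
    intro k
    refine (hlink k _ (sub_mem_links (hu k) (hu (k + 1)))).trans ?_
    have hδ : (0 : ℝ) ≤ (1 / 2 : ℝ) ^ k := by positivity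
    have hn : ‖u (k + 1) - u k‖ ≤ 3 / 2 * (1 / 2 : ℝ) ^ k := by
      have h1 := norm_sub_le_norm_sub_add_norm_sub (u (k + 1)) g (u k)
      rw [norm_sub_rev (u (k + 1)) g] at h1
      have h2 := hgu (k + 1)
      rw [pow_succ] at h2
      linarith [hgu k]
    have hs : √(empiricalNormSq x (u (k + 1) - u k) + ((1 / 2 : ℝ) ^ k) ^ 2)
        ≤ 2 * (1 / 2 : ℝ) ^ k := by
      have h2 := empiricalNormSq_le_of_norm_le x hn
      exact Real.sqrt_le_iff.2 ⟨by positivity, by nlinarith⟩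
    calc Z * (q ^ k * √(empiricalNormSq x (u (k + 1) - u k) + ((1 / 2 : ℝ) ^ k) ^ 2))
        ≤ Z * (q ^ k * (2 * (1 / 2 : ℝ) ^ k)) := by gcongr
      _ = 2 * Z * r ^ k := by rw [← hrk]; ring
  have hchain : ∀ j, |noiseSum x e (u (m + j))|
      ≤ Z * (q ^ m * (2 * G + 2 * (1 / 2 : ℝ) ^ m))
        + 2 * Z * ((r ^ m - r ^ (m + j)) / (1 - r)) := by
    intro j
    induction j with
    | zero => simpa using hstart
    | succ j ih =>
      have h1 := hstep (m + j)
      rw [noiseSum_sub] at h1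
      have h2 := abs_sub_abs_le_abs_sub (noiseSum x e (u (m + j + 1)))
        (noiseSum x e (u (m + j)))
      have h3 : (r ^ m - r ^ (m + j + 1)) / (1 - r)
          = (r ^ m - r ^ (m + j)) / (1 - r) + r ^ (m + j) := by
        field_simp
        ring
      rw [← add_assoc, h3]
      linarith
  set B := (√(n : ℝ))⁻¹ * ∑ i, |e i| with hB_def
  have hB : 0 ≤ B := by positivity
  -- the remainder after `j` steps is not controlled by links, but by a crude sup-norm bound
  have hfin : ∀ j : ℕ, |noiseSum x e g| ≤ (Z * (q ^ m * (2 * G + 2 * (1 / 2 : ℝ) ^ m))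
        + 2 * Z * (r ^ m / (1 - r))) + B * (1 / 2 : ℝ) ^ j := by
    intro j
    have h1 := abs_noiseSum_le x e (g - u (m + j))
    rw [noiseSum_sub] at h1
    have h2 := abs_sub_abs_le_abs_sub (noiseSum x e g) (noiseSum x e (u (m + j)))
    have h3 : B * ‖g - u (m + j)‖ ≤ B * (1 / 2 : ℝ) ^ j := by
      gcongr
      exact (hgu (m + j)).trans
        (pow_le_pow_of_le_one (by norm_num) (by norm_num) (Nat.le_add_left j m))
    have h4 : (r ^ m - r ^ (m + j)) / (1 - r) ≤ r ^ m / (1 - r) := by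
      gcongr
      have : 0 ≤ r ^ (m + j) := by positivity
      linarith
    have h5 := hchain j
    nlinarith [mul_le_mul_of_nonneg_left h4 hZ]
  have hlim : Filter.Tendsto (fun j : ℕ => (Z * (q ^ m * (2 * G + 2 * (1 / 2 : ℝ) ^ m))
      + 2 * Z * (r ^ m / (1 - r))) + B * (1 / 2 : ℝ) ^ j) Filter.atTop
      (nhds ((Z * (q ^ m * (2 * G + 2 * (1 / 2 : ℝ) ^ m)) + 2 * Z * (r ^ m / (1 - r)))
        + B * 0)) :=
    ((tendsto_pow_atTop_nhds_zero_of_lt_one (by norm_num) (by norm_num)).const_mul B).const_add _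
  refine (ge_of_tendsto' hlim hfin).trans ?_
  rw [← hrk m]
  have hpos : 0 ≤ 2 / (1 - r) * Z * q ^ m * G := by positivity
  have e1 : 2 * Z * (q ^ m * (1 / 2 : ℝ) ^ m / (1 - r))
      = 2 / (1 - r) * Z * q ^ m * (1 / 2 : ℝ) ^ m := by ring
  rw [e1]
  nlinarith

/-! ### The conditional expectation of the chaining sum -/

theorem measurable_empiricalNormSq {d n : ℕ} (u : C(Cube d, ℝ)) :
    Measurable fun x : Fin n → Cube d => empiricalNormSq x u := by
  unfold empiricalNormSq
  fun_prop

theorem IsSubgaussianSample.measurable_linkRatio {Ω : Type*} [MeasurableSpace Ω] {μ : Measure Ω}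
    {d n : ℕ} {X : Fin n → Ω → Cube d} {e : Fin n → Ω → ℝ} {b : ℝ}
    (h : IsSubgaussianSample μ X e b) (k : ℕ) (u : C(Cube d, ℝ)) :
    Measurable fun ω => linkRatio k u (fun i => X i ω) (fun i => e i ω) := by
  have hX := h.measurable_X
  have he := h.measurable_noise
  have h1 := (measurable_empiricalNormSq u).comp (measurable_pi_lambda _ hX)
  unfold linkRatio noiseSum
  refine Measurable.div ?_ (Real.continuous_sqrt.measurable.comp (h1.add_const _))
  refine Measurable.const_mul (Finset.measurable_fun_sum _ fun i _ => ?_) _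
  have := u.measurable.comp (hX i)
  exact (he i).mul this

/-- The normalized noise is subgaussian with the constant `b` of the noise, whatever `u` and `k`. -/
theorem IsSubgaussianSample.setLIntegral_exp_linkRatio_le {Ω : Type*} [MeasurableSpace Ω]
    {μ : Measure Ω} [IsProbabilityMeasure μ] {d n : ℕ} {X : Fin n → Ω → Cube d}
    {e : Fin n → Ω → ℝ} {b : ℝ} (h : IsSubgaussianSample μ X e b)
    {A : Set (Fin n → Cube d)} (hA : MeasurableSet A) (k : ℕ) (u : C(Cube d, ℝ)) (s : ℝ) :
    ∫⁻ ω in (fun ω i => X i ω) ⁻¹' A, ENNReal.ofReal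
        (Real.exp (s * linkRatio k u (fun i => X i ω) (fun i => e i ω))) ∂μ
      ≤ ENNReal.ofReal (Real.exp (b ^ 2 * s ^ 2 / 2)) * μ ((fun ω i => X i ω) ⁻¹' A) := by
  set R : (Fin n → Cube d) → ℝ := fun x => √(empiricalNormSq x u + ((1 / 2 : ℝ) ^ k) ^ 2)
    with hR
  have hRm : Measurable R :=
    Real.continuous_sqrt.measurable.comp ((measurable_empiricalNormSq u).add_const _)
  let τ : Fin n → (Fin n → Cube d) → ℝ := fun i x => s * ((√(n : ℝ))⁻¹ * (u (x i) / R x))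
  have hτ : ∀ i, Measurable (τ i) := by
    intro i
    have : Measurable fun x : Fin n → Cube d => u (x i) :=
      u.measurable.comp (measurable_pi_apply i)
    exact ((this.div hRm).const_mul _).const_mul _
  have hV : ∀ x, ∑ i, τ i x ^ 2 ≤ s ^ 2 := by
    intro x
    have hnorm := empiricalNormSq_nonneg x u
    have hRpos : 0 < empiricalNormSq x u + ((1 / 2 : ℝ) ^ k) ^ 2 :=
      add_pos_of_nonneg_of_pos hnorm (by positivity)
    have hR2 : R x ^ 2 = empiricalNormSq x u + ((1 / 2 : ℝ) ^ k) ^ 2 := Real.sq_sqrt hRpos.le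
    have e1 : ∑ i, τ i x ^ 2 = s ^ 2 * (empiricalNormSq x u / R x ^ 2) := by
      simp only [τ, empiricalNormSq, mul_pow, div_pow, inv_pow, Real.sq_sqrt (Nat.cast_nonneg n)]
      rw [← Finset.mul_sum, ← Finset.mul_sum, ← Finset.sum_div]
      ring
    rw [e1, hR2]
    refine mul_le_of_le_one_right (sq_nonneg s) ((div_le_one hRpos).2 ?_)
    have : (0 : ℝ) ≤ ((1 / 2 : ℝ) ^ k) ^ 2 := by positivity
    linarith
  refine le_trans (le_of_eq ?_) (h.setLIntegral_exp_le hA hτ hV)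
  refine lintegral_congr fun ω => ?_
  congr 2
  simp only [linkRatio, noiseSum, τ, hR, Finset.mul_sum, Finset.sum_div]
  exact Finset.sum_congr rfl fun i _ => by ring

theorem IsSubgaussianSample.measurable_chainSum {Ω : Type*} [MeasurableSpace Ω] {μ : Measure Ω}
    {d n : ℕ} {X : Fin n → Ω → Cube d} {e : Fin n → Ω → ℝ} {b : ℝ}
    (h : IsSubgaussianSample μ X e b) (q T : ℝ) (N : ℕ → Finset C(Cube d, ℝ)) :
    Measurable fun ω => chainSum q T N (fun i => X i ω) (fun i => e i ω) := by
  unfold chainSum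
  refine Measurable.tsum fun k => Finset.measurable_fun_sum _ fun u _ => ?_
  have := h.measurable_linkRatio k u
  fun_prop

/-- The conditional expectation of `chainSum` given the design is bounded by a constant. In the
discount, `b ^ 2 / 2` pays for the exponential moment, `5 * D` for the number of links, and `1`
makes the levels summable. -/
theorem IsSubgaussianSample.setLIntegral_chainSum_le {Ω : Type*} [MeasurableSpace Ω]
    {μ : Measure Ω} [IsProbabilityMeasure μ] {d n : ℕ} {X : Fin n → Ω → Cube d}
    {e : Fin n → Ω → ℝ} {b : ℝ} (h : IsSubgaussianSample μ X e b) {D q : ℝ} (hD : 0 ≤ D)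
    (hq1 : 1 < q) (hq2 : q ≤ 2) {N : ℕ → Finset C(Cube d, ℝ)}
    (hN : ∀ k, ((N k).card : ℝ) ≤ Real.exp (D * (q ^ k) ^ 2))
    {A : Set (Fin n → Cube d)} (hA : MeasurableSet A) :
    ∫⁻ ω in (fun ω i => X i ω) ⁻¹' A,
        chainSum q (b ^ 2 / 2 + 5 * D + 1) N (fun i => X i ω) (fun i => e i ω) ∂μ
      ≤ ENNReal.ofReal (4 * (1 - (q ^ 2)⁻¹)⁻¹) * μ ((fun ω i => X i ω) ⁻¹' A) := by
  set T := b ^ 2 / 2 + 5 * D + 1 with hT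
  have hterm : ∀ k u (s : ℝ), s ^ 2 = (q ^ k) ^ 2 →
      ∫⁻ ω in (fun ω i => X i ω) ⁻¹' A, ENNReal.ofReal (Real.exp
        (s * linkRatio k u (fun i => X i ω) (fun i => e i ω) - (q ^ k) ^ 2 * T)) ∂μ
      ≤ ENNReal.ofReal (Real.exp (-(5 * D + 1) * (q ^ k) ^ 2)) *
          μ ((fun ω i => X i ω) ⁻¹' A) := by
    intro k u s hs
    have e1 : ∀ ω, ENNReal.ofReal (Real.exp
        (s * linkRatio k u (fun i => X i ω) (fun i => e i ω) - (q ^ k) ^ 2 * T))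
        = ENNReal.ofReal (Real.exp (-((q ^ k) ^ 2 * T))) * ENNReal.ofReal (Real.exp
          (s * linkRatio k u (fun i => X i ω) (fun i => e i ω))) := by
      intro ω
      rw [← ENNReal.ofReal_mul (Real.exp_pos _).le, ← Real.exp_add]
      congr 2; ring
    simp only [e1]
    have hm := h.measurable_linkRatio k u
    rw [lintegral_const_mul _ (by fun_prop)]
    refine (mul_le_mul_right (h.setLIntegral_exp_linkRatio_le hA k u s) _).trans (le_of_eq ?_)
    rw [← mul_assoc, ← ENNReal.ofReal_mul (Real.exp_pos _).le, ← Real.exp_add, hs, hT]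
    congr 3; ring
  have hlevel : ∀ k, ∫⁻ ω in (fun ω i => X i ω) ⁻¹' A, ∑ u ∈ links N k,
      (ENNReal.ofReal (Real.exp (q ^ k * linkRatio k u (fun i => X i ω) (fun i => e i ω)
        - (q ^ k) ^ 2 * T)) +
      ENNReal.ofReal (Real.exp (-(q ^ k * linkRatio k u (fun i => X i ω) (fun i => e i ω))
        - (q ^ k) ^ 2 * T))) ∂μ
      ≤ ENNReal.ofReal (4 * ((q ^ 2)⁻¹) ^ k) * μ ((fun ω i => X i ω) ⁻¹' A) := by
    intro k
    rw [lintegral_finsetSum _ fun u _ => by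
      have := h.measurable_linkRatio k u
      fun_prop]
    have hu : ∀ u ∈ links N k, ∫⁻ ω in (fun ω i => X i ω) ⁻¹' A,
        (ENNReal.ofReal (Real.exp (q ^ k * linkRatio k u (fun i => X i ω) (fun i => e i ω)
          - (q ^ k) ^ 2 * T)) +
        ENNReal.ofReal (Real.exp (-(q ^ k * linkRatio k u (fun i => X i ω) (fun i => e i ω))
          - (q ^ k) ^ 2 * T))) ∂μ
        ≤ 2 * (ENNReal.ofReal (Real.exp (-(5 * D + 1) * (q ^ k) ^ 2)) *
          μ ((fun ω i => X i ω) ⁻¹' A)) := by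
      intro u _
      have hm := h.measurable_linkRatio k u
      rw [lintegral_add_left (by fun_prop), two_mul]
      refine add_le_add (hterm k u _ rfl) ?_
      simp only [← neg_mul]
      exact hterm k u _ (neg_sq _)
    refine (Finset.sum_le_sum hu).trans ?_
    rw [Finset.sum_const, nsmul_eq_mul, ← mul_assoc, ← mul_assoc]
    gcongr
    have hcard := card_links_le hD (by linarith) hq2 hN k
    have hs : 0 < (q ^ k) ^ 2 := by positivity
    have hexp : Real.exp (-(q ^ k) ^ 2) ≤ ((q ^ k) ^ 2)⁻¹ := by
      rw [Real.exp_neg]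
      gcongr
      linarith [Real.add_one_le_exp ((q ^ k) ^ 2)]
    rw [← ENNReal.ofReal_natCast, ← ENNReal.ofReal_ofNat, ← ENNReal.ofReal_mul (by positivity),
      ← ENNReal.ofReal_mul (by positivity)]
    refine ENNReal.ofReal_le_ofReal ?_
    calc ((links N k).card : ℝ) * 2 * Real.exp (-(5 * D + 1) * (q ^ k) ^ 2)
        ≤ 2 * Real.exp (5 * D * (q ^ k) ^ 2) * 2 * Real.exp (-(5 * D + 1) * (q ^ k) ^ 2) := by
          gcongr
      _ = 4 * (Real.exp (5 * D * (q ^ k) ^ 2) * Real.exp (-(5 * D + 1) * (q ^ k) ^ 2)) := by ring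
      _ = 4 * Real.exp (-(q ^ k) ^ 2) := by
          rw [← Real.exp_add]
          congr 2; ring
      _ ≤ 4 * ((q ^ 2)⁻¹) ^ k := by
          rw [inv_pow, pow_right_comm q 2 k]
          gcongr
  unfold chainSum
  rw [lintegral_tsum fun k => (Finset.measurable_fun_sum _ fun u _ => by
    have := h.measurable_linkRatio k u
    fun_prop).aemeasurable]
  refine (ENNReal.tsum_le_tsum hlevel).trans (le_of_eq ?_)
  have hr0 : (0 : ℝ) ≤ (q ^ 2)⁻¹ := by positivity
  have hr1 : (q ^ 2)⁻¹ < 1 := inv_lt_one_of_one_lt₀ (by nlinarith)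
  rw [ENNReal.tsum_mul_right, ← ENNReal.ofReal_tsum_of_nonneg (fun k => by positivity)
    ((summable_geometric_of_lt_one hr0 hr1).mul_left 4), tsum_mul_left,
    tsum_geometric_of_lt_one hr0 hr1]

/-- Nets of the unit ball at the scales `2^{-k}`, with the entropy written in terms of
`q = 2^{β/2}`. -/
theorem exists_nets {d : ℕ} {F : Submodule ℝ C(Cube d, ℝ)} {p : Seminorm ℝ F} {D β : ℝ}
    (hF : EntropyBound F p D β) :
    ∃ N : ℕ → Finset C(Cube d, ℝ),
      (∀ k, ((N k).card : ℝ) ≤ Real.exp (D * (((2 : ℝ) ^ (β / 2)) ^ k) ^ 2)) ∧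
      ∀ k, ∀ g : F, p g ≤ 1 → ∃ u ∈ N k, ‖(g : C(Cube d, ℝ)) - u‖ ≤ (1 / 2 : ℝ) ^ k := by
  choose N hN hcov using fun k : ℕ =>
    exists_net_unitBall hF (δ := (1 / 2 : ℝ) ^ k) (by positivity)
  refine ⟨N, fun k => (hN k).trans (le_of_eq ?_), hcov⟩
  congr 2
  rw [← pow_mul, ← Real.rpow_natCast, ← Real.rpow_natCast, ← Real.rpow_mul (by norm_num),
    ← Real.rpow_mul (by norm_num), one_div, Real.inv_rpow (by norm_num), ← Real.rpow_neg
    (by norm_num)]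
  congr 1
  push_cast
  ring

/-- The noise process on the whole space, at an arbitrary scale `2^{-m}`. -/
theorem abs_noiseSum_le_of_chainSum {d n : ℕ} {F : Submodule ℝ C(Cube d, ℝ)}
    {p : Seminorm ℝ F} {q T : ℝ} (hq1 : 1 ≤ q) (hq2 : q < 2) (hT : 0 ≤ T)
    {N : ℕ → Finset C(Cube d, ℝ)}
    (hcov : ∀ k, ∀ g : F, p g ≤ 1 → ∃ u ∈ N k, ‖(g : C(Cube d, ℝ)) - u‖ ≤ (1 / 2 : ℝ) ^ k)
    {x : Fin n → Cube d} {e : Fin n → ℝ} (hW : chainSum q T N x e ≠ ⊤) (g : F) {P : ℝ}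
    (hP : 0 < P) (hg : p g ≤ P) (m : ℕ) :
    |noiseSum x e g| ≤ (2 + 2 / (1 - q / 2)) *
      (T + Real.log (1 + (chainSum q T N x e).toReal)) * q ^ m *
      (√(empiricalNormSq x (g : C(Cube d, ℝ))) + P * (1 / 2 : ℝ) ^ m) := by
  have hL : 0 ≤ Real.log (1 + (chainSum q T N x e).toReal) :=
    Real.log_nonneg (by linarith [ENNReal.toReal_nonneg (a := chainSum q T N x e)])
  have h1 : p (P⁻¹ • g) ≤ 1 := by
    rw [map_smul_eq_mul, Real.norm_of_nonneg (by positivity), inv_mul_le_iff₀ hP, mul_one]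
    exact hg
  have h2 := abs_noiseSum_le_of_chain (by linarith) hq2 (by positivity)
    (fun k u hu => abs_noiseSum_le_of_mem_links hq1 hW hu)
    (fun k => hcov k (P⁻¹ • g) h1) m
  rw [Submodule.coe_smul, noiseSum_smul, empiricalNormSq_smul, Real.sqrt_mul (sq_nonneg _),
    Real.sqrt_sq (by positivity), abs_mul, abs_of_pos (by positivity : 0 < P⁻¹),
    inv_mul_le_iff₀ hP] at h2
  refine h2.trans (le_of_eq ?_)
  field_simp

/-! ### The penalized minimizer -/

/-- The scale `2^{-m}` which balances the two terms of the chaining bound for functions of seminorm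
at most `P`. The common value of both terms is the rate `r = n^{-1/(2+β)} P^{β/(2+β)}`. -/
theorem exists_scale {β : ℝ} (hβ : 0 < β) {n : ℕ} (hn : 1 ≤ n) {P : ℝ} (hP : 1 ≤ P) :
    ∃ m : ℕ,
      (√(n : ℝ))⁻¹ * ((2 : ℝ) ^ (β / 2)) ^ m ≤ (n : ℝ) ^ (-1 / (2 + β)) * P ^ (β / (2 + β)) ∧
      P * (1 / 2 : ℝ) ^ m ≤ 2 * ((n : ℝ) ^ (-1 / (2 + β)) * P ^ (β / (2 + β))) := by
  have hn1 : (1 : ℝ) ≤ n := by exact_mod_cast hn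
  have hn0 : (0 : ℝ) < n := by linarith
  have hP0 : 0 < P := by linarith
  have hβ2 : 0 < 2 + β := by linarith
  set δ : ℝ := (n : ℝ) ^ (-1 / (2 + β)) * P ^ (-2 / (2 + β)) with hδ
  have hδ0 : 0 < δ := by positivity
  have hδ1 : δ ≤ 1 := by
    refine mul_le_one₀ (Real.rpow_le_one_of_one_le_of_nonpos hn1 ?_) (by positivity)
      (Real.rpow_le_one_of_one_le_of_nonpos hP ?_)
    · exact div_nonpos_of_nonpos_of_nonneg (by norm_num) hβ2.le
    · exact div_nonpos_of_nonpos_of_nonneg (by norm_num) hβ2.le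
  obtain ⟨m, hm1, hm2⟩ := exists_nat_pow_near_of_lt_one hδ0 hδ1
    (by norm_num : (0 : ℝ) < 1 / 2) (by norm_num)
  refine ⟨m, ?_, ?_⟩
  · have e1 : ((2 : ℝ) ^ (β / 2)) ^ m = ((1 / 2 : ℝ) ^ m) ^ (-(β / 2)) := by
      rw [one_div, inv_pow, Real.inv_rpow (by positivity), ← Real.rpow_neg (by positivity),
        neg_neg, ← Real.rpow_natCast, ← Real.rpow_natCast, ← Real.rpow_mul (by norm_num),
        ← Real.rpow_mul (by norm_num), mul_comm]
    have h1 : ((2 : ℝ) ^ (β / 2)) ^ m ≤ δ ^ (-(β / 2)) := by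
      rw [e1]
      exact Real.rpow_le_rpow_of_nonpos hδ0 hm2 (by linarith)
    refine (mul_le_mul_of_nonneg_left h1 (by positivity)).trans (le_of_eq ?_)
    rw [hδ, Real.mul_rpow (by positivity) (by positivity), ← Real.rpow_mul hn0.le,
      ← Real.rpow_mul hP0.le, Real.sqrt_eq_rpow, ← Real.rpow_neg hn0.le, ← mul_assoc,
      ← Real.rpow_add hn0]
    congr 2
    · field_simp
      ring
    · field_simp
  · have h1 : (1 / 2 : ℝ) ^ m ≤ 2 * δ := by
      rw [pow_succ] at hm1
      linarith
    have h2 : P * P ^ (-2 / (2 + β)) = P ^ (β / (2 + β)) := by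
      nth_rewrite 1 [← Real.rpow_one P]
      rw [← Real.rpow_add hP0]
      congr 1
      field_simp
      ring
    calc P * (1 / 2 : ℝ) ^ m ≤ P * (2 * δ) := by gcongr
      _ = 2 * ((n : ℝ) ^ (-1 / (2 + β)) * (P * P ^ (-2 / (2 + β)))) := by rw [hδ]; ring
      _ = _ := by rw [h2]

/-- The square of the rate. The exponent `2β/(β+2)` of `P` is the one `α` has to exceed. -/
theorem rate_sq {β : ℝ} (n : ℕ) {P : ℝ} (hP : 0 ≤ P) :
    ((n : ℝ) ^ (-1 / (2 + β)) * P ^ (β / (2 + β))) ^ 2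
      = (n : ℝ) ^ (-2 / (2 + β)) * P ^ (2 * β / (β + 2)) := by
  rw [mul_pow, ← Real.rpow_natCast, ← Real.rpow_natCast, ← Real.rpow_mul (Nat.cast_nonneg n),
    ← Real.rpow_mul hP]
  congr 2
  · push_cast; ring
  · push_cast; rw [add_comm β 2]; ring

/-- The basic inequality: a penalized minimizer is compared with `f₀`. -/
theorem IsPERM.basic_inequality {d n : ℕ} {F : Submodule ℝ C(Cube d, ℝ)} {p : Seminorm ℝ F}
    {h α : ℝ} {x : Fin n → Cube d} {y : Fin n → ℝ} {f : F} (hf : IsPERM F p h α x y f) (f₀ : F) :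
    empiricalNormSq x ((f : C(Cube d, ℝ)) - f₀) + h ^ 2 * p f ^ α
      ≤ 2 * ((√(n : ℝ))⁻¹ * noiseSum x (fun i => y i - (f₀ : C(Cube d, ℝ)) (x i))
          ((f : C(Cube d, ℝ)) - f₀)) + h ^ 2 * p f₀ ^ α := by
  have h0 := hf f₀
  have e1 : (√(n : ℝ))⁻¹ * noiseSum x (fun i => y i - (f₀ : C(Cube d, ℝ)) (x i))
      ((f : C(Cube d, ℝ)) - f₀) = (1 / (n : ℝ)) * ∑ i, (y i - (f₀ : C(Cube d, ℝ)) (x i)) *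
        ((f : C(Cube d, ℝ)) (x i) - (f₀ : C(Cube d, ℝ)) (x i)) := by
    rw [noiseSum, ← mul_assoc, ← mul_inv, Real.mul_self_sqrt (Nat.cast_nonneg n), one_div]
    rfl
  have e2 : ∑ i, (y i - (f : C(Cube d, ℝ)) (x i)) ^ 2
      = ∑ i, (y i - (f₀ : C(Cube d, ℝ)) (x i)) ^ 2
        - 2 * ∑ i, (y i - (f₀ : C(Cube d, ℝ)) (x i)) *
          ((f : C(Cube d, ℝ)) (x i) - (f₀ : C(Cube d, ℝ)) (x i))
        + ∑ i, ((f : C(Cube d, ℝ)) (x i) - (f₀ : C(Cube d, ℝ)) (x i)) ^ 2 := by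
    rw [Finset.mul_sum, ← Finset.sum_sub_distrib, ← Finset.sum_add_distrib]
    exact Finset.sum_congr rfl fun i _ => by ring
  rw [e1]
  simp only [empiricalRisk, empiricalNormSq, ContinuousMap.sub_apply, e2] at h0 ⊢
  linarith

/-- The deterministic heart of the argument: the loss and the penalty of a penalized minimizer are
bounded in terms of `chainSum`. The condition on `α` says that the stochastic term, of order
`P ^ (2β/(β+2))` in the seminorm, is absorbed by the penalty. -/
theorem exists_IsPERM_bound {a β α T : ℝ} (ha : 0 < a) (hβ0 : 0 < β) (hβ2 : β < 2)
    (hα : 2 * β / (β + 2) < α) (hT : 0 ≤ T) :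
    ∃ C : ℝ, 0 < C ∧ ∀ (d n : ℕ) (F : Submodule ℝ C(Cube d, ℝ)) (p : Seminorm ℝ F)
      (N : ℕ → Finset C(Cube d, ℝ)), 1 ≤ n →
      (∀ k, ∀ g : F, p g ≤ 1 → ∃ u ∈ N k, ‖(g : C(Cube d, ℝ)) - u‖ ≤ (1 / 2 : ℝ) ^ k) →
      ∀ (x : Fin n → Cube d) (y : Fin n → ℝ) (f₀ f : F) (W : ℝ≥0∞),
        W = chainSum ((2 : ℝ) ^ (β / 2)) T N x (fun i => y i - (f₀ : C(Cube d, ℝ)) (x i)) →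
        W ≠ ⊤ → IsPERM F p (a * (n : ℝ) ^ (-1 / (2 + β))) α x y f →
        empiricalNormSq x ((f : C(Cube d, ℝ)) - f₀)
            ≤ C * (n : ℝ) ^ (-2 / (2 + β)) * (1 + p f₀ ^ α + W.toReal) ∧
          p f ^ α ≤ C * (1 + p f₀ ^ α + W.toReal) := by
  set q : ℝ := (2 : ℝ) ^ (β / 2) with hq
  have hq1 : 1 ≤ q := Real.one_le_rpow (by norm_num) (by linarith)
  have hq2 : q < 2 := by
    have := Real.rpow_lt_rpow_of_exponent_lt (by norm_num : (1 : ℝ) < 2)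
      (by linarith : β / 2 < 1)
    rwa [Real.rpow_one] at this
  set M : ℝ := (2 + 2 / (1 - q / 2)) * (T + 1) with hM
  have hK : 0 < 2 + 2 / (1 - q / 2) := by
    have : 0 < 1 - q / 2 := by linarith
    positivity
  have hM0 : 0 < M := by positivity
  set M' : ℝ := 2 * M ^ 2 + 4 * M with hM'
  have hM'0 : 0 < M' := by positivity
  set γ : ℝ := 2 * β / (β + 2) with hγ
  have hγ0 : 0 < γ := by positivity
  have hγ1 : γ ≤ 1 := by rw [hγ, div_le_one (by positivity)]; linarith
  -- with this constant, Young's inequality costs half of the penalty `a ^ 2 * η * p f ^ α`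
  obtain ⟨C, hC, hyoung⟩ := exists_one_add_add_rpow_mul_sq_le hγ0 hγ1 hα
    (by positivity : 0 < a ^ 2 / (2 * M'))
  set B : ℝ := M' * C + a ^ 2 with hB
  have hB0 : 0 < B := by positivity
  refine ⟨2 * B + 2 * B / a ^ 2, by positivity, ?_⟩
  intro d n F p N hn hcov x y f₀ f W hWdef hW hf
  have hn0 : (0 : ℝ) < n := by exact_mod_cast hn
  set η : ℝ := (n : ℝ) ^ (-2 / (2 + β)) with hη
  have hη0 : 0 < η := by positivity
  have hf0 := apply_nonneg p f
  have hf00 := apply_nonneg p f₀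
  set P : ℝ := 1 + p f + p f₀ with hP
  have hP1 : 1 ≤ P := by linarith
  have hg : p (f - f₀) ≤ P := (map_sub_le_add p f f₀).trans (by linarith)
  obtain ⟨m, hm1, hm2⟩ := exists_scale hβ0 hn hP1
  have hr2 := rate_sq (β := β) n (by linarith : 0 ≤ P)
  set r : ℝ := (n : ℝ) ^ (-1 / (2 + β)) * P ^ (β / (2 + β)) with hr
  have hr0 : 0 ≤ r := by positivity
  have hh : (a * (n : ℝ) ^ (-1 / (2 + β))) ^ 2 = a ^ 2 * η := by
    rw [mul_pow, ← Real.rpow_natCast (_ ^ _), ← Real.rpow_mul hn0.le, hη]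
    congr 2
    push_cast; ring
  set L : ℝ := Real.log (1 + W.toReal) with hL
  have hL0 : 0 ≤ L := Real.log_nonneg (by linarith [ENNReal.toReal_nonneg (a := W)])
  set G : ℝ := √(empiricalNormSq x ((f : C(Cube d, ℝ)) - f₀)) with hG
  have hG0 : 0 ≤ G := Real.sqrt_nonneg _
  have hG2 : G ^ 2 = empiricalNormSq x ((f : C(Cube d, ℝ)) - f₀) :=
    Real.sq_sqrt (empiricalNormSq_nonneg x _)
  have hbasic := hf.basic_inequality f₀
  rw [hh, ← hG2] at hbasic
  set ξ : ℝ := noiseSum x (fun i => y i - (f₀ : C(Cube d, ℝ)) (x i))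
    ((f : C(Cube d, ℝ)) - f₀) with hξ
  have hnoise : |ξ| ≤ M * (1 + L) * q ^ m * (G + P * (1 / 2 : ℝ) ^ m) := by
    have h1 := abs_noiseSum_le_of_chainSum hq1 hq2 hT hcov (hWdef ▸ hW) (f - f₀)
      (by linarith) hg m
    rw [← hWdef] at h1
    refine h1.trans ?_
    have h2 : (2 + 2 / (1 - q / 2)) * (T + L) ≤ M * (1 + L) := by
      rw [hM, mul_assoc]
      have h3 : T + L ≤ (T + 1) * (1 + L) := by linarith [mul_nonneg hT hL0]
      exact mul_le_mul_of_nonneg_left h3 hK.le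
    change (2 + 2 / (1 - q / 2)) * (T + L) * q ^ m * (G + P * (1 / 2 : ℝ) ^ m) ≤ _
    gcongr
  have hstoch : (√(n : ℝ))⁻¹ * ξ ≤ M * (1 + L) * r * (G + 2 * r) := by
    calc (√(n : ℝ))⁻¹ * ξ ≤ (√(n : ℝ))⁻¹ * (M * (1 + L) * q ^ m * (G + P * (1 / 2 : ℝ) ^ m)) := by
          gcongr
          exact (le_abs_self _).trans hnoise
      _ = M * (1 + L) * ((√(n : ℝ))⁻¹ * q ^ m) * (G + P * (1 / 2 : ℝ) ^ m) := by ring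
      _ ≤ M * (1 + L) * r * (G + 2 * r) := by gcongr
  have hquad : 2 * (M * (1 + L) * r * (G + 2 * r))
      ≤ G ^ 2 / 2 + M' * (r ^ 2 * (1 + L) ^ 2) := by
    have h1 : 4 * M * r ^ 2 * (1 + L) ≤ 4 * M * r ^ 2 * (1 + L) ^ 2 := by
      have h2 : 1 + L ≤ (1 + L) ^ 2 := le_self_pow₀ (by linarith) two_ne_zero
      exact mul_le_mul_of_nonneg_left h2 (by positivity)
    rw [hM']
    linarith [sq_nonneg (G - 2 * (M * (1 + L) * r))]
  have hy := hyoung (p f) (p f₀) W.toReal hf0 hf00 ENNReal.toReal_nonneg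
  have hpα : 0 ≤ p f ^ α := by positivity
  have hp0α : 0 ≤ p f₀ ^ α := by positivity
  have hW0 : 0 ≤ W.toReal := ENNReal.toReal_nonneg
  set S : ℝ := 1 + p f₀ ^ α + W.toReal with hS
  have hS0 : 0 < S := by positivity
  have hy2 : M' * (r ^ 2 * (1 + L) ^ 2) ≤ η * (a ^ 2 / 2 * p f ^ α + M' * C * S) := by
    have h1 := mul_le_mul_of_nonneg_left hy (by positivity : 0 ≤ M' * η)
    rw [hr2]
    calc M' * (η * P ^ γ * (1 + L) ^ 2) = M' * η * (P ^ γ * (1 + L) ^ 2) := by ring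
      _ ≤ M' * η * (a ^ 2 / (2 * M') * p f ^ α + C * S) := h1
      _ = _ := by field_simp
  have hfinal : G ^ 2 / 2 + η * (a ^ 2 / 2 * p f ^ α) ≤ η * (B * S) := by
    have h1 : a ^ 2 * η * p f₀ ^ α ≤ η * (a ^ 2 * S) := by
      have : p f₀ ^ α ≤ S := by linarith
      calc a ^ 2 * η * p f₀ ^ α ≤ a ^ 2 * η * S := by gcongr
        _ = _ := by ring
    rw [hB]
    linarith
  have hBS : 0 ≤ η * (2 * B / a ^ 2 * S) := by positivity
  constructor
  · rw [← hG2]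
    have : 0 ≤ η * (a ^ 2 / 2 * p f ^ α) := by positivity
    linarith
  · have h1 : η * (a ^ 2 / 2 * p f ^ α) ≤ η * (B * S) := by linarith [sq_nonneg G]
    have h2 : a ^ 2 / 2 * p f ^ α ≤ B * S := le_of_mul_le_mul_left h1 hη0
    have h3 : p f ^ α ≤ 2 * B / a ^ 2 * S := by
      rw [div_mul_eq_mul_div, le_div_iff₀ (by positivity)]
      linarith
    have : 0 ≤ 2 * B * S := by positivity
    linarith

/-! ### Comparison of the empirical and the population norm -/

theorem designNormSq_le_two_mul {d : ℕ} (PX : Measure (Cube d)) [IsProbabilityMeasure PX]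
    (g u : C(Cube d, ℝ)) {δ : ℝ} (h : ‖g - u‖ ≤ δ) :
    designNormSq PX g ≤ 2 * designNormSq PX u + 2 * δ ^ 2 := by
  have hint : ∀ v : C(Cube d, ℝ), Integrable (fun x => v x ^ 2) PX := fun v =>
    (v.continuous.pow 2).integrable_of_hasCompactSupport (HasCompactSupport.of_compactSpace _)
  have h1 : ∫ x, g x ^ 2 ∂PX ≤ ∫ x, (2 * u x ^ 2 + 2 * δ ^ 2) ∂PX := by
    refine integral_mono (hint g) (((hint u).const_mul 2).add (integrable_const _)) fun x => ?_
    have h2 : |g x - u x| ≤ δ := ((g - u).norm_coe_le_norm x).trans h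
    have h3 := sq_le_sq' (abs_le.1 h2).1 (abs_le.1 h2).2
    dsimp only
    nlinarith [sq_nonneg (g x - 2 * u x)]
  rw [integral_add ((hint u).const_mul 2) (integrable_const _), integral_const_mul,
    integral_const, probReal_univ, one_smul] at h1
  exact h1

/-- One-sided exponential bound for the difference of the two norms of a bounded function. Only the
lower deviations of the nonnegative variables `u (X i) ^ 2` matter, so that boundedness suffices. -/
theorem lintegral_exp_designNormSq_sub_le {Ω : Type*} [MeasurableSpace Ω] {μ : Measure Ω}
    [IsProbabilityMeasure μ] {d n : ℕ} {PX : Measure (Cube d)} {X : Fin n → Ω → Cube d}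
    (hn : 1 ≤ n) (hX : ∀ i, Measurable (X i)) (hlaw : ∀ i, μ.map (X i) = PX)
    (hindep : iIndepFun X μ) {Q : ℝ} (hQ : 0 < Q) {u : C(Cube d, ℝ)} (hu : ‖u‖ ≤ Q) :
    ∫⁻ ω, ENNReal.ofReal (Real.exp ((n : ℝ) / Q ^ 2 *
        (designNormSq PX u / 2 - empiricalNormSq (fun i => X i ω) u))) ∂μ ≤ 1 := by
  have hn0 : (0 : ℝ) < n := by exact_mod_cast hn
  set f : Fin n → Ω → ℝ := fun i ω => u (X i ω) ^ 2 with hf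
  have hfm : ∀ i, Measurable (f i) := fun i => (u.measurable.comp (hX i)).pow_const 2
  have hfi : iIndepFun f μ :=
    hindep.comp (fun _ x => u x ^ 2) fun _ => u.measurable.pow_const 2
  have hf0 : ∀ i ω, 0 ≤ f i ω := fun i ω => sq_nonneg _
  have hfQ : ∀ i ω, f i ω ≤ Q ^ 2 := fun i ω =>
    sq_le_sq.2 (((u.norm_coe_le_norm _).trans hu).trans (le_abs_self Q))
  have hfint : ∀ i, Integrable (f i) μ := fun i =>
    .of_bound (hfm i).aestronglyMeasurable (Q ^ 2) (.of_forall fun ω => by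
      rw [Real.norm_of_nonneg (hf0 i ω)]
      exact hfQ i ω)
  have hmean : ∀ i, ∫ ω, f i ω ∂μ = designNormSq PX u := by
    intro i
    rw [designNormSq, ← hlaw i, integral_map (hX i).aemeasurable
      (u.measurable.pow_const 2).aestronglyMeasurable]
  set t : ℝ := (Q ^ 2)⁻¹ with ht
  have ht0 : 0 < t := by positivity
  have hone : ∀ i, mgf (f i) μ (-t) ≤ Real.exp (-(t * designNormSq PX u / 2)) := by
    intro i
    -- `exp (-y) ≤ 1 / (1 + y) ≤ 1 - y / 2` for `y ∈ [0, 1]`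
    have hpt : ∀ ω, Real.exp (-t * f i ω) ≤ 1 - t / 2 * f i ω := by
      intro ω
      have hy0 : 0 ≤ t * f i ω := mul_nonneg ht0.le (hf0 i ω)
      have hy1 : t * f i ω ≤ 1 := by
        rw [ht, inv_mul_le_iff₀ (by positivity), mul_one]
        exact hfQ i ω
      have h1 : Real.exp (-t * f i ω) ≤ (1 + t * f i ω)⁻¹ := by
        rw [neg_mul, Real.exp_neg]
        gcongr
        linarith [Real.add_one_le_exp (t * f i ω)]
      refine h1.trans ?_
      rw [inv_le_iff_one_le_mul₀ (by linarith)]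
      nlinarith
    have hi2 : Integrable (fun ω => 1 - t / 2 * f i ω) μ :=
      (integrable_const _).sub ((hfint i).const_mul _)
    have hi1 : Integrable (fun ω => Real.exp (-t * f i ω)) μ :=
      .of_bound (Real.measurable_exp.comp ((hfm i).const_mul _)).aestronglyMeasurable 1
        (.of_forall fun ω => by
          rw [Real.norm_of_nonneg (Real.exp_pos _).le]
          have := mul_nonneg (by positivity : 0 ≤ t / 2) (hf0 i ω)
          linarith [hpt ω])
    calc mgf (f i) μ (-t) ≤ ∫ ω, (1 - t / 2 * f i ω) ∂μ := integral_mono hi1 hi2 hpt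
      _ = 1 - t / 2 * designNormSq PX u := by
          rw [integral_sub (integrable_const _) ((hfint i).const_mul _), integral_const_mul,
            hmean i]
          simp
      _ ≤ Real.exp (-(t * designNormSq PX u / 2)) := by
          linarith [Real.add_one_le_exp (-(t * designNormSq PX u / 2))]
  have hmgf := hfi.mgf_sum (t := -t) hfm Finset.univ
  have hprod : mgf (∑ i, f i) μ (-t) ≤ Real.exp (-(t * designNormSq PX u / 2)) ^ n := by
    rw [hmgf]
    refine (Finset.prod_le_prod (fun i _ => mgf_nonneg) fun i _ => hone i).trans (le_of_eq ?_)
    rw [Finset.prod_const, Finset.card_univ, Fintype.card_fin]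
  have hsum : Integrable (fun ω => Real.exp (-t * (∑ i, f i) ω)) μ :=
    .of_bound (by
      simp only [Finset.sum_apply]
      have := Finset.measurable_fun_sum Finset.univ fun i _ => hfm i
      fun_prop) 1
      (.of_forall fun ω => by
        rw [Real.norm_of_nonneg (Real.exp_pos _).le, Real.exp_le_one_iff, Finset.sum_apply]
        have := Finset.sum_nonneg fun i (_ : i ∈ Finset.univ) => hf0 i ω
        nlinarith)
  have hexp : ∀ ω, Real.exp ((n : ℝ) / Q ^ 2 *
      (designNormSq PX u / 2 - empiricalNormSq (fun i => X i ω) u))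
      = Real.exp (n * (t * designNormSq PX u / 2)) * Real.exp (-t * (∑ i, f i) ω) := by
    intro ω
    rw [← Real.exp_add, Finset.sum_apply, empiricalNormSq, ht]
    congr 1
    field_simp
    ring
  simp only [hexp]
  rw [← ofReal_integral_eq_lintegral_ofReal (hsum.const_mul _)
    (.of_forall fun ω => by positivity), integral_const_mul]
  refine ENNReal.ofReal_le_one.2 ?_
  refine (mul_le_mul_of_nonneg_left hprod (Real.exp_pos _).le).trans (le_of_eq ?_)
  rw [← Real.exp_nat_mul, ← Real.exp_add]
  simp

/-- The radius at which `{g | p g ≤ 2 ^ j}` is covered in the comparison of the norms. It balances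
the entropy against `n` times the squared radius. -/
noncomputable def coverRadius (β : ℝ) (n j : ℕ) : ℝ :=
  (n : ℝ) ^ (-1 / (2 + β)) * ((2 : ℝ) ^ j) ^ (β / (2 + β))

theorem coverRadius_pos {β : ℝ} {n : ℕ} (hn : 1 ≤ n) (j : ℕ) : 0 < coverRadius β n j := by
  have hn0 : (0 : ℝ) < n := by exact_mod_cast hn
  unfold coverRadius
  positivity

/-- The entropy of the ball of radius `2 ^ j` at the radius `coverRadius β n j`. -/
theorem entropy_coverRadius {β : ℝ} (hβ : 0 < β) {n : ℕ} (hn : 1 ≤ n) (j : ℕ) :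
    ((2 : ℝ) ^ j / coverRadius β n j) ^ β = n * coverRadius β n j ^ 2 := by
  have hn0 : (0 : ℝ) < n := by exact_mod_cast hn
  have hP : (0 : ℝ) < 2 ^ j := by positivity
  have h1 : (2 : ℝ) ^ j / coverRadius β n j
      = (n : ℝ) ^ (1 / (2 + β)) * ((2 : ℝ) ^ j) ^ (2 / (2 + β)) := by
    unfold coverRadius
    rw [div_eq_iff (by positivity), mul_mul_mul_comm, ← Real.rpow_add hn0, ← Real.rpow_add hP]
    have e1 : 1 / (2 + β) + -1 / (2 + β) = 0 := by ring
    have e2 : 2 / (2 + β) + β / (2 + β) = 1 := by field_simp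
    rw [e1, e2, Real.rpow_zero, Real.rpow_one, one_mul]
  rw [h1, Real.mul_rpow (by positivity) (by positivity), ← Real.rpow_mul hn0.le,
    ← Real.rpow_mul hP.le, coverRadius, rate_sq n hP.le, ← mul_assoc]
  nth_rewrite 2 [← Real.rpow_one (n : ℝ)]
  rw [← Real.rpow_add hn0]
  congr 2
  · field_simp
    ring
  · rw [add_comm β 2]; ring

/-- The entropies grow geometrically in `j`, uniformly in `n`. -/
theorem pow_le_mul_coverRadius_sq {β : ℝ} (hβ : 0 < β) {n : ℕ} (hn : 1 ≤ n) (j : ℕ) :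
    ((2 : ℝ) ^ (2 * β / (β + 2))) ^ j ≤ n * coverRadius β n j ^ 2 := by
  have hn1 : (1 : ℝ) ≤ n := by exact_mod_cast hn
  have hn0 : (0 : ℝ) < n := by linarith
  have hP : (0 : ℝ) < 2 ^ j := by positivity
  rw [coverRadius, rate_sq n hP.le, ← mul_assoc]
  nth_rewrite 1 [← Real.rpow_one (n : ℝ)]
  rw [← Real.rpow_add hn0, ← Real.rpow_natCast, ← Real.rpow_natCast,
    ← Real.rpow_mul (by norm_num), ← Real.rpow_mul (by norm_num), mul_comm (j : ℝ)]
  refine le_mul_of_one_le_left (by positivity) (Real.one_le_rpow hn1 ?_)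
  have e1 : 1 + -2 / (2 + β) = β / (2 + β) := by
    field_simp
    ring
  rw [e1]
  positivity

/-- Comparison of the two norms, uniformly over the bounded part of `F`: the population norm is at
most a multiple of the empirical norm, up to the rate, which grows with the seminorm only as
`P ^ (2β/(β+2))`. -/
theorem exists_norm_comparison {Ω : Type*} [MeasurableSpace Ω] {μ : Measure Ω}
    [IsProbabilityMeasure μ] {d n : ℕ} {F : Submodule ℝ C(Cube d, ℝ)} {p : Seminorm ℝ F}
    {D β : ℝ} (hF : EntropyBound F p D β) (hD : 0 ≤ D) (hβ : 0 < β)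
    {PX : Measure (Cube d)} {X : Fin n → Ω → Cube d}
    (hn : 1 ≤ n) (hX : ∀ i, Measurable (X i)) (hlaw : ∀ i, μ.map (X i) = PX)
    (hindep : iIndepFun X μ) {Q : ℝ} (hQ : 0 < Q) :
    ∃ V : Ω → ℝ≥0∞, Measurable V ∧
      ∫⁻ ω, V ω ∂μ ≤ ENNReal.ofReal ((1 - ((2 : ℝ) ^ (2 * β / (β + 2)))⁻¹)⁻¹) ∧
      ∀ ω, V ω ≠ ⊤ → ∀ (g : F) (P : ℝ), ‖(g : C(Cube d, ℝ))‖ ≤ Q → 1 ≤ P → p g ≤ P →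
        designNormSq PX g ≤ 8 * empiricalNormSq (fun i => X i ω) (g : C(Cube d, ℝ)) +
          (160 + 16 * Q ^ 2 * (D + 1)) * ((n : ℝ) ^ (-2 / (2 + β)) * P ^ (2 * β / (β + 2))) *
            (1 + Real.log (1 + (V ω).toReal)) := by
  have hn0 : (0 : ℝ) < n := by exact_mod_cast hn
  have : IsProbabilityMeasure PX := by
    rw [← hlaw ⟨0, hn⟩]
    exact Measure.isProbabilityMeasure_map (hX _).aemeasurable
  set γ : ℝ := 2 * β / (β + 2) with hγ
  have hγ0 : 0 < γ := by positivity
  set ρ : ℕ → ℝ := coverRadius β n with hρ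
  have hρ0 : ∀ j, 0 < ρ j := coverRadius_pos hn
  choose N hNcard hNQ hNcov using fun j : ℕ =>
    exists_net_ball_inter hF (hρ0 j) (by positivity : (0 : ℝ) < 2 ^ j) Q
  have hw : ∀ j, ((2 : ℝ) ^ γ) ^ j ≤ n * ρ j ^ 2 := pow_le_mul_coverRadius_sq hβ hn
  have hXm : Measurable fun ω i => X i ω := measurable_pi_lambda _ hX
  let term : ℕ → C(Cube d, ℝ) → Ω → ℝ≥0∞ := fun j u ω =>
    ENNReal.ofReal (Real.exp ((n : ℝ) / Q ^ 2 *
      (designNormSq PX u / 2 - empiricalNormSq (fun i => X i ω) u) - n * ρ j ^ 2 * (D + 1)))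
  have hterm_meas : ∀ j u, Measurable (term j u) := by
    intro j u
    have := (measurable_empiricalNormSq u).comp hXm
    simp only [Function.comp_def] at this
    simp only [term]
    fun_prop
  have hterm : ∀ j, ∀ u ∈ N j, ∫⁻ ω, term j u ω ∂μ
      ≤ ENNReal.ofReal (Real.exp (-(n * ρ j ^ 2 * (D + 1)))) := by
    intro j u hu
    have e1 : ∀ ω, term j u ω = ENNReal.ofReal (Real.exp (-(n * ρ j ^ 2 * (D + 1)))) *
        ENNReal.ofReal (Real.exp ((n : ℝ) / Q ^ 2 *
          (designNormSq PX u / 2 - empiricalNormSq (fun i => X i ω) u))) := by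
      intro ω
      rw [← ENNReal.ofReal_mul (Real.exp_pos _).le, ← Real.exp_add]
      simp only [term]
      congr 2; ring
    simp only [e1]
    have hm := (measurable_empiricalNormSq u).comp hXm
    simp only [Function.comp_def] at hm
    rw [lintegral_const_mul _ (by fun_prop)]
    exact mul_le_of_le_one_right'
      (lintegral_exp_designNormSq_sub_le hn hX hlaw hindep hQ (hNQ j u hu))
  refine ⟨fun ω => ∑' j, ∑ u ∈ N j, term j u ω, ?_, ?_, ?_⟩
  · exact Measurable.tsum fun j => Finset.measurable_fun_sum _ fun u _ => hterm_meas j u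
  · rw [lintegral_tsum fun j =>
      (Finset.measurable_fun_sum _ fun u _ => hterm_meas j u).aemeasurable]
    have hlevel : ∀ j, ∫⁻ ω, ∑ u ∈ N j, term j u ω ∂μ
        ≤ ENNReal.ofReal ((((2 : ℝ) ^ γ)⁻¹) ^ j) := by
      intro j
      rw [lintegral_finsetSum _ fun u _ => hterm_meas j u]
      refine (Finset.sum_le_sum (hterm j)).trans ?_
      rw [Finset.sum_const, nsmul_eq_mul, ← ENNReal.ofReal_natCast,
        ← ENNReal.ofReal_mul (by positivity)]
      refine ENNReal.ofReal_le_ofReal ?_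
      have hcard : ((N j).card : ℝ) ≤ Real.exp (D * (n * ρ j ^ 2)) := by
        rw [← entropy_coverRadius hβ hn j]
        exact hNcard j
      have hpos : (0 : ℝ) < ((2 : ℝ) ^ γ) ^ j := by positivity
      calc ((N j).card : ℝ) * Real.exp (-(n * ρ j ^ 2 * (D + 1)))
          ≤ Real.exp (D * (n * ρ j ^ 2)) * Real.exp (-(n * ρ j ^ 2 * (D + 1))) := by gcongr
        _ = (Real.exp (n * ρ j ^ 2))⁻¹ := by
            rw [← Real.exp_add, ← Real.exp_neg]
            congr 1; ring
        _ ≤ (((2 : ℝ) ^ γ) ^ j)⁻¹ := by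
            gcongr
            linarith [hw j, Real.add_one_le_exp (n * ρ j ^ 2)]
        _ = _ := by rw [inv_pow]
    have h2γ : 1 < (2 : ℝ) ^ γ := Real.one_lt_rpow (by norm_num) hγ0
    have hr0 : (0 : ℝ) ≤ ((2 : ℝ) ^ γ)⁻¹ := by positivity
    have hr1 : ((2 : ℝ) ^ γ)⁻¹ < 1 := inv_lt_one_of_one_lt₀ h2γ
    refine (ENNReal.tsum_le_tsum hlevel).trans (le_of_eq ?_)
    rw [← ENNReal.ofReal_tsum_of_nonneg (fun j => by positivity)
      (summable_geometric_of_lt_one hr0 hr1), tsum_geometric_of_lt_one hr0 hr1]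
  · intro ω hV g P hgQ hP hgP
    set V : ℝ≥0∞ := ∑' j, ∑ u ∈ N j, term j u ω with hVdef
    have hL : 0 ≤ Real.log (1 + V.toReal) :=
      Real.log_nonneg (by linarith [ENNReal.toReal_nonneg (a := V)])
    obtain ⟨i, hi1, hi2⟩ := exists_nat_pow_near hP (by norm_num : (1 : ℝ) < 2)
    set j := i + 1 with hj
    obtain ⟨u, hu, hgu⟩ := hNcov j g (hgP.trans hi2.le) hgQ
    have hle : term j u ω ≤ V :=
      (Finset.single_le_sum (f := fun u => term j u ω) (fun _ _ => zero_le) hu).trans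
        (ENNReal.le_tsum (f := fun j => ∑ u ∈ N j, term j u ω) j)
    have hexp := (ENNReal.ofReal_le_iff_le_toReal hV).1 hle
    have hlog := (Real.le_log_iff_exp_le (by linarith [ENNReal.toReal_nonneg (a := V)])).2
      (hexp.trans (by linarith : V.toReal ≤ 1 + V.toReal))
    have hρj : 0 < ρ j ^ 2 := pow_pos (hρ0 j) 2
    have hnρ : 1 ≤ n * ρ j ^ 2 :=
      (one_le_pow₀ (Real.one_le_rpow (by norm_num) hγ0.le)).trans (hw j)
    set L := Real.log (1 + V.toReal) with hLdef
    have hdev : designNormSq PX u ≤ 2 * empiricalNormSq (fun i => X i ω) u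
        + 2 * Q ^ 2 * (D + 1) * ρ j ^ 2 * (1 + L) := by
      have h1 : (n : ℝ) / Q ^ 2 * (designNormSq PX u / 2 - empiricalNormSq (fun i => X i ω) u)
          ≤ n * ρ j ^ 2 * ((D + 1) * (1 + L)) := by
        have h2 : L ≤ n * ρ j ^ 2 * L := le_mul_of_one_le_left hL hnρ
        have h3 : 0 ≤ n * ρ j ^ 2 * (D * L) := by positivity
        linarith
      have h4 : designNormSq PX u / 2 - empiricalNormSq (fun i => X i ω) u
          ≤ Q ^ 2 * (ρ j ^ 2 * ((D + 1) * (1 + L))) := by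
        rw [div_mul_eq_mul_div, div_le_iff₀ (by positivity)] at h1
        refine le_of_mul_le_mul_left ?_ hn0
        linarith
      linarith
    have hρP : ρ j ^ 2 ≤ 4 * ((n : ℝ) ^ (-2 / (2 + β)) * P ^ γ) := by
      have h1 : ρ j ^ 2 = (n : ℝ) ^ (-2 / (2 + β)) * ((2 : ℝ) ^ j) ^ γ :=
        rate_sq n (by positivity)
      have h2 : ((2 : ℝ) ^ j) ^ γ ≤ (2 * P) ^ γ := by
        refine Real.rpow_le_rpow (by positivity) ?_ hγ0.le
        rw [hj, pow_succ]
        linarith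
      have h3 : (2 : ℝ) ^ γ ≤ 4 := by
        have h4 : γ ≤ (2 : ℕ) := by
          rw [hγ, div_le_iff₀ (by positivity)]
          push_cast
          linarith
        have := Real.rpow_le_rpow_of_exponent_le (by norm_num : (1 : ℝ) ≤ 2) h4
        rw [Real.rpow_natCast] at this
        linarith
      rw [Real.mul_rpow (by norm_num) (by linarith)] at h2
      have h5 : (0 : ℝ) ≤ P ^ γ := Real.rpow_nonneg (by linarith) _
      have h6 : (0 : ℝ) ≤ (n : ℝ) ^ (-2 / (2 + β)) := by positivity
      rw [h1]
      calc (n : ℝ) ^ (-2 / (2 + β)) * ((2 : ℝ) ^ j) ^ γ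
          ≤ (n : ℝ) ^ (-2 / (2 + β)) * (4 * P ^ γ) := by
            refine mul_le_mul_of_nonneg_left (h2.trans ?_) h6
            exact mul_le_mul_of_nonneg_right h3 h5
        _ = _ := by ring
    have hd := designNormSq_le_two_mul PX _ u hgu
    have he := empiricalNormSq_le_two_mul (fun i => X i ω) (g : C(Cube d, ℝ)) u
    have he2 := empiricalNormSq_le_of_norm_le (fun i => X i ω) hgu
    have hρL : ρ j ^ 2 ≤ ρ j ^ 2 * (1 + L) := le_mul_of_one_le_right hρj.le (by linarith)
    have hcoef : 0 ≤ (40 + 4 * Q ^ 2 * (D + 1)) * (1 + L) := by positivity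
    have h7 := mul_le_mul_of_nonneg_left hρP hcoef
    linarith

/-! ### Conditional expectations and measurability of the estimator -/

/-- A bound on `∫ V` over the sets of a sub-sigma-algebra gives a bound on the conditional
expectation of every `f` dominated by an affine function of `V`. -/
theorem condExp_le_of_setLIntegral_le {Ω : Type*} {m m0 : MeasurableSpace Ω} {μ : Measure Ω}
    [IsProbabilityMeasure μ] (hm : m ≤ m0) {V : Ω → ℝ≥0∞} (hV : Measurable V) {B : ℝ}
    (hB : 0 ≤ B) (hset : ∀ s, MeasurableSet[m] s → ∫⁻ ω in s, V ω ∂μ ≤ ENNReal.ofReal B * μ s)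
    {f : Ω → ℝ} (hf : Integrable f μ) {K c : ℝ} (hK : 0 ≤ K)
    (hle : ∀ᵐ ω ∂μ, f ω ≤ K * (c + (V ω).toReal)) :
    μ[f | m] ≤ᵐ[μ] fun _ => K * (c + B) := by
  have hVint : ∫⁻ ω, V ω ∂μ ≠ ⊤ := by
    have := hset Set.univ MeasurableSet.univ
    rw [Measure.restrict_univ, measure_univ, mul_one] at this
    exact (this.trans_lt ENNReal.ofReal_lt_top).ne
  have hVi := integrable_toReal_of_lintegral_ne_top hV.aemeasurable hVint
  refine ae_le_of_ae_le_trim (hm := hm) ?_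
  refine ae_le_of_forall_setIntegral_le (integrable_condExp.trim hm stronglyMeasurable_condExp)
    (integrable_const _) fun s hs _ => ?_
  rw [← setIntegral_trim hm stronglyMeasurable_condExp hs, setIntegral_condExp hm hf hs,
    ← setIntegral_trim hm stronglyMeasurable_const hs]
  have hVs : ∫ ω in s, (V ω).toReal ∂μ ≤ B * μ.real s := by
    rw [integral_toReal hV.aemeasurable (ae_restrict_of_ae (ae_lt_top hV hVint))]
    refine (ENNReal.toReal_mono (by finiteness) (hset s hs)).trans (le_of_eq ?_)
    rw [ENNReal.toReal_mul, ENNReal.toReal_ofReal hB, Measure.real]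
  calc ∫ ω in s, f ω ∂μ ≤ ∫ ω in s, K * (c + (V ω).toReal) ∂μ :=
        setIntegral_mono_ae hf.integrableOn
          ((((integrable_const c).add hVi).const_mul K).integrableOn) hle
    _ = K * (c * μ.real s + ∫ ω in s, (V ω).toReal ∂μ) := by
        rw [integral_const_mul, integral_add (integrable_const c) hVi.integrableOn,
          setIntegral_const, smul_eq_mul, mul_comm c]
    _ ≤ K * (c * μ.real s + B * μ.real s) := by gcongr
    _ = ∫ _ω in s, K * (c + B) ∂μ := by
        rw [setIntegral_const, smul_eq_mul]
        ring

/-- The evaluation of the estimator is jointly measurable, being continuous in the point. -/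
theorem IsPERMEstimator.measurable_eval_prod {Ω : Type*} [MeasurableSpace Ω] {μ : Measure Ω}
    {d n : ℕ} {F : Submodule ℝ C(Cube d, ℝ)} {p : Seminorm ℝ F} {a β α : ℝ}
    {X : Fin n → Ω → Cube d} {Y : Fin n → Ω → ℝ} {fbar : Ω → F}
    (h : IsPERMEstimator μ F p a β α X Y fbar) :
    Measurable fun z : Cube d × Ω => (fbar z.2 : C(Cube d, ℝ)) z.1 :=
  measurable_uncurry_of_continuous_of_measurable
    (u := fun (x : Cube d) (ω : Ω) => (fbar ω : C(Cube d, ℝ)) x)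
    (fun ω => (fbar ω : C(Cube d, ℝ)).continuous) h.measurable_eval

theorem IsPERMEstimator.measurable_empiricalNormSq {Ω : Type*} [MeasurableSpace Ω]
    {μ : Measure Ω} {d n : ℕ} {F : Submodule ℝ C(Cube d, ℝ)} {p : Seminorm ℝ F} {a β α : ℝ}
    {X : Fin n → Ω → Cube d} {Y : Fin n → Ω → ℝ} {fbar : Ω → F}
    (h : IsPERMEstimator μ F p a β α X Y fbar) (hX : ∀ i, Measurable (X i)) (f₀ : F) :
    Measurable fun ω => empiricalNormSq (fun i => X i ω)
      ((fbar ω : C(Cube d, ℝ)) - (f₀ : C(Cube d, ℝ))) := by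
  simp only [empiricalNormSq, ContinuousMap.sub_apply]
  refine Measurable.const_mul (Finset.measurable_fun_sum _ fun i _ => ?_) _
  have h1 := h.measurable_eval_prod.comp ((hX i).prodMk measurable_id)
  exact (h1.sub ((f₀ : C(Cube d, ℝ)).measurable.comp (hX i))).pow_const 2

theorem IsPERMEstimator.measurable_designNormSq {Ω : Type*} [MeasurableSpace Ω]
    {μ : Measure Ω} {d n : ℕ} {F : Submodule ℝ C(Cube d, ℝ)} {p : Seminorm ℝ F} {a β α : ℝ}
    {X : Fin n → Ω → Cube d} {Y : Fin n → Ω → ℝ} {fbar : Ω → F}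
    (h : IsPERMEstimator μ F p a β α X Y fbar) (PX : Measure (Cube d)) [SFinite PX] (f₀ : F) :
    StronglyMeasurable fun ω => designNormSq PX
      ((fbar ω : C(Cube d, ℝ)) - (f₀ : C(Cube d, ℝ))) := by
  simp only [designNormSq, ContinuousMap.sub_apply]
  have h1 := h.measurable_eval_prod.comp (measurable_swap (α := Ω) (β := Cube d))
  have h2 : Measurable fun z : Ω × Cube d =>
      ((fbar z.1 : C(Cube d, ℝ)) z.2 - (f₀ : C(Cube d, ℝ)) z.2) ^ 2 :=
    (h1.sub ((f₀ : C(Cube d, ℝ)).measurable.comp measurable_snd)).pow_const 2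
  exact h2.stronglyMeasurable.integral_prod_right'

/-- The chaining bound for the estimator: its empirical loss and its seminorm are dominated by a
random variable `W` whose conditional expectation given the design is at most `B`. -/
theorem exists_estimator_bound {a β α b D : ℝ} (ha : 0 < a) (hβ0 : 0 < β) (hβ2 : β < 2)
    (hα : 2 * β / (β + 2) < α) (hD : 0 < D) :
    ∃ C B : ℝ, 0 < C ∧ 0 ≤ B ∧
      ∀ (d : ℕ) (F : Submodule ℝ C(Cube d, ℝ)) (p : Seminorm ℝ F), EntropyBound F p D β →
      ∀ (f₀ : F) (σ bε : ℝ), σ * bε = b →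
      ∀ (PX : Measure (Cube d)) (n : ℕ), 1 ≤ n →
      ∀ (Ω : Type u) [MeasurableSpace Ω] (μ : Measure Ω) [IsProbabilityMeasure μ]
        (X : Fin n → Ω → Cube d) (ε Y : Fin n → Ω → ℝ) (fbar : Ω → F),
        IsRegressionSample μ PX (f₀ : C(Cube d, ℝ)) σ bε X ε Y →
        IsPERMEstimator μ F p a β α X Y fbar →
        ∃ W : Ω → ℝ≥0∞, Measurable W ∧
          (∀ s, MeasurableSet[designSigma X] s →
            ∫⁻ ω in s, W ω ∂μ ≤ ENNReal.ofReal B * μ s) ∧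
          ∀ᵐ ω ∂μ, empiricalNormSq (fun i => X i ω)
              ((fbar ω : C(Cube d, ℝ)) - (f₀ : C(Cube d, ℝ)))
                ≤ C * (n : ℝ) ^ (-2 / (2 + β)) * (1 + p f₀ ^ α + (W ω).toReal) ∧
            p (fbar ω) ^ α ≤ C * (1 + p f₀ ^ α + (W ω).toReal) := by
  set q : ℝ := (2 : ℝ) ^ (β / 2) with hq
  have hq1 : 1 < q := Real.one_lt_rpow (by norm_num) (by linarith)
  have hq2 : q ≤ 2 := by
    have := Real.rpow_le_rpow_of_exponent_le (by norm_num : (1 : ℝ) ≤ 2)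
      (by linarith : β / 2 ≤ 1)
    rwa [Real.rpow_one] at this
  have hT : 0 ≤ b ^ 2 / 2 + 5 * D + 1 := by positivity
  obtain ⟨C, hC, hmain⟩ := exists_IsPERM_bound ha hβ0 hβ2 hα hT
  have hB : 0 ≤ 4 * (1 - (q ^ 2)⁻¹)⁻¹ := by
    have : (q ^ 2)⁻¹ < 1 := inv_lt_one_of_one_lt₀ (by nlinarith)
    have : 0 < 1 - (q ^ 2)⁻¹ := by linarith
    positivity
  refine ⟨C, 4 * (1 - (q ^ 2)⁻¹)⁻¹, hC, hB, ?_⟩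
  intro d F p hF f₀ σ bε hσb PX n hn Ω _ μ _ X ε Y fbar hS hE
  obtain ⟨N, hNcard, hNcov⟩ := exists_nets hF
  have hsub := hS.isSubgaussianSample
  rw [hσb] at hsub
  set T := b ^ 2 / 2 + 5 * D + 1
  let W : Ω → ℝ≥0∞ := fun ω => chainSum q T N (fun i => X i ω)
    (fun i => Y i ω - (f₀ : C(Cube d, ℝ)) (X i ω))
  have hWm : Measurable W := hsub.measurable_chainSum q T N
  have hset : ∀ s, MeasurableSet[designSigma X] s →
      ∫⁻ ω in s, W ω ∂μ ≤ ENNReal.ofReal (4 * (1 - (q ^ 2)⁻¹)⁻¹) * μ s := by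
    rintro s ⟨A, hA, rfl⟩
    exact hsub.setLIntegral_chainSum_le hD.le hq1 hq2 hNcard hA
  refine ⟨W, hWm, hset, ?_⟩
  have hfin : ∫⁻ ω, W ω ∂μ ≠ ⊤ := by
    have := hset Set.univ MeasurableSet.univ
    rw [Measure.restrict_univ, measure_univ, mul_one] at this
    exact (this.trans_lt ENNReal.ofReal_lt_top).ne
  filter_upwards [hE.isPERM, ae_lt_top hWm hfin] with ω hω hWω
  exact hmain d n F p N hn hNcov _ _ f₀ (fbar ω) (W ω) rfl hWω.ne hω

theorem integrable_of_le_affine {Ω : Type*} [MeasurableSpace Ω] {μ : Measure Ω}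
    [IsProbabilityMeasure μ] {V : Ω → ℝ≥0∞} (hV : Measurable V) (hVint : ∫⁻ ω, V ω ∂μ ≠ ⊤)
    {f : Ω → ℝ} (hf : AEStronglyMeasurable f μ) (hf0 : ∀ ω, 0 ≤ f ω) {K c : ℝ}
    (hle : ∀ᵐ ω ∂μ, f ω ≤ K * (c + (V ω).toReal)) : Integrable f μ := by
  have hVi := integrable_toReal_of_lintegral_ne_top hV.aemeasurable hVint
  refine (((integrable_const c).add hVi).const_mul K).mono' hf ?_
  filter_upwards [hle] with ω hω
  rw [Real.norm_of_nonneg (hf0 ω)]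
  exact hω

end PERM

/-! ### The two risk bounds -/

theorem theorem2 (a β α b D : ℝ) (ha : 0 < a) (hβ0 : 0 < β) (hβ2 : β < 2)
    (hα : 2 * β / (β + 2) < α) (hb : 0 < b) (hD : 0 < D) :
    (∃ C₁ : ℝ, 0 < C₁ ∧ ∃ n₁ : ℕ,
      ∀ (d : ℕ) (F : Submodule ℝ C(PERM.Cube d, ℝ)) (p : Seminorm ℝ F),
        PERM.EntropyBound F p D β →
      ∀ (f₀ : F) (σ bε : ℝ), 0 < σ → 0 < bε → σ * bε = b →
      ∀ (PX : Measure (PERM.Cube d)) (n : ℕ), n₁ ≤ n →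
      ∀ (Ω : Type u) [MeasurableSpace Ω] (μ : Measure Ω) [IsProbabilityMeasure μ]
        (X : Fin n → Ω → PERM.Cube d) (ε Y : Fin n → Ω → ℝ) (fbar : Ω → F),
        PERM.IsRegressionSample μ PX (f₀ : C(PERM.Cube d, ℝ)) σ bε X ε Y →
        PERM.IsPERMEstimator μ F p a β α X Y fbar →
        Integrable (fun ω => PERM.empiricalNormSq (fun i => X i ω)
            ((fbar ω : C(PERM.Cube d, ℝ)) - (f₀ : C(PERM.Cube d, ℝ)))) μ ∧
        μ[fun ω => PERM.empiricalNormSq (fun i => X i ω)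
            ((fbar ω : C(PERM.Cube d, ℝ)) - (f₀ : C(PERM.Cube d, ℝ))) | PERM.designSigma X]
          ≤ᵐ[μ] fun _ => C₁ * (1 + p f₀ ^ α) * (n : ℝ) ^ (-2 / (2 + β))) ∧
    (∀ Q : ℝ, 0 < Q → ∃ C₂ : ℝ, 0 < C₂ ∧ ∃ n₂ : ℕ,
      ∀ (d : ℕ) (F : Submodule ℝ C(PERM.Cube d, ℝ)) (p : Seminorm ℝ F),
        PERM.EntropyBound F p D β →
      ∀ (f₀ : F) (σ bε : ℝ), 0 < σ → 0 < bε → σ * bε = b →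
      ∀ (PX : Measure (PERM.Cube d)) (n : ℕ), n₂ ≤ n →
      ∀ (Ω : Type u) [MeasurableSpace Ω] (μ : Measure Ω) [IsProbabilityMeasure μ]
        (X : Fin n → Ω → PERM.Cube d) (ε Y : Fin n → Ω → ℝ) (fbar : Ω → F),
        PERM.IsRegressionSample μ PX (f₀ : C(PERM.Cube d, ℝ)) σ bε X ε Y →
        PERM.IsPERMEstimator μ F p a β α X Y fbar →
        (∀ᵐ ω ∂μ, ‖(fbar ω : C(PERM.Cube d, ℝ)) - (f₀ : C(PERM.Cube d, ℝ))‖ ≤ Q) →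
        Integrable (fun ω => PERM.designNormSq PX
            ((fbar ω : C(PERM.Cube d, ℝ)) - (f₀ : C(PERM.Cube d, ℝ)))) μ ∧
        ∫ ω, PERM.designNormSq PX
            ((fbar ω : C(PERM.Cube d, ℝ)) - (f₀ : C(PERM.Cube d, ℝ))) ∂μ
          ≤ C₂ * (1 + p f₀ ^ α) * (n : ℝ) ^ (-2 / (2 + β))) := by
  constructor
  · obtain ⟨C, B, hC, hB, h⟩ := PERM.exists_estimator_bound.{u} (b := b) ha hβ0 hβ2 hα hD
    refine ⟨C * (1 + B), by positivity, 1, ?_⟩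
    intro d F p hF f₀ σ bε _ _ hσb PX n hn Ω _ μ _ X ε Y fbar hS hE
    obtain ⟨W, hWm, hset, hae⟩ := h d F p hF f₀ σ bε hσb PX n hn Ω μ X ε Y fbar hS hE
    have hfin : ∫⁻ ω, W ω ∂μ ≠ ⊤ := by
      have := hset Set.univ MeasurableSet.univ
      rw [Measure.restrict_univ, measure_univ, mul_one] at this
      exact (this.trans_lt ENNReal.ofReal_lt_top).ne
    have hle : ∀ᵐ ω ∂μ, PERM.empiricalNormSq (fun i => X i ω)
        ((fbar ω : C(PERM.Cube d, ℝ)) - (f₀ : C(PERM.Cube d, ℝ)))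
        ≤ C * (n : ℝ) ^ (-2 / (2 + β)) * (1 + p f₀ ^ α + (W ω).toReal) :=
      hae.mono fun ω hω => hω.1
    have hint := PERM.integrable_of_le_affine hWm hfin
      (hE.measurable_empiricalNormSq hS.measurable_X f₀).aestronglyMeasurable
      (fun ω => PERM.empiricalNormSq_nonneg _ _) hle
    refine ⟨hint, ?_⟩
    have hm : PERM.designSigma X ≤ (inferInstance : MeasurableSpace Ω) :=
      (measurable_pi_lambda _ hS.measurable_X).comap_le
    filter_upwards [PERM.condExp_le_of_setLIntegral_le hm hWm hB hset hint (by positivity) hle]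
      with ω hω
    refine hω.trans ?_
    have hp : 0 ≤ p f₀ ^ α := Real.rpow_nonneg (apply_nonneg p f₀) α
    have hη : 0 ≤ C * (n : ℝ) ^ (-2 / (2 + β)) := by positivity
    calc C * (n : ℝ) ^ (-2 / (2 + β)) * (1 + p f₀ ^ α + B)
        ≤ C * (n : ℝ) ^ (-2 / (2 + β)) * ((1 + B) * (1 + p f₀ ^ α)) := by
          gcongr
          nlinarith [mul_nonneg hB hp]
      _ = _ := by ring
  · intro Q hQ
    obtain ⟨C, B, hC, hB, h⟩ := PERM.exists_estimator_bound.{u} (b := b) ha hβ0 hβ2 hα hD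
    have hγ0 : 0 < 2 * β / (β + 2) := by positivity
    have hγ1 : 2 * β / (β + 2) ≤ 1 := by rw [div_le_one (by positivity)]; linarith
    obtain ⟨C', hC', hyoung⟩ := PERM.exists_one_add_add_rpow_mul_sq_le hγ0 hγ1 hα one_pos
    set γ : ℝ := 2 * β / (β + 2) with hγ
    set M : ℝ := 160 + 16 * Q ^ 2 * (D + 1) with hM
    have hM0 : 0 < M := by positivity
    set B' : ℝ := (1 - ((2 : ℝ) ^ γ)⁻¹)⁻¹ with hB'
    have hB'0 : 0 ≤ B' := by
      have h1 : ((2 : ℝ) ^ γ)⁻¹ < 1 :=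
        inv_lt_one_of_one_lt₀ (Real.one_lt_rpow (by norm_num) hγ0)
      have : 0 < 1 - ((2 : ℝ) ^ γ)⁻¹ := by linarith
      positivity
    set K : ℝ := 8 * C + M * (C + C') with hK
    have hK0 : 0 < K := by positivity
    refine ⟨K * (1 + (B + B')), by positivity, 1, ?_⟩
    intro d F p hF f₀ σ bε _ _ hσb PX n hn Ω _ μ _ X ε Y fbar hS hE hbdd
    obtain ⟨W, hWm, hset, hae⟩ := h d F p hF f₀ σ bε hσb PX n hn Ω μ X ε Y fbar hS hE
    have hindep : iIndepFun X μ := hS.indep.comp (fun _ z => z.1) fun _ => measurable_fst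
    obtain ⟨V, hVm, hVint, hV⟩ := PERM.exists_norm_comparison hF hD.le hβ0 hn hS.measurable_X
      hS.law_X hindep hQ
    have : IsProbabilityMeasure PX := by
      rw [← hS.law_X ⟨0, hn⟩]
      exact Measure.isProbabilityMeasure_map (hS.measurable_X _).aemeasurable
    have hWint : ∫⁻ ω, W ω ∂μ ≤ ENNReal.ofReal B := by
      have := hset Set.univ MeasurableSet.univ
      rwa [Measure.restrict_univ, measure_univ, mul_one] at this
    have hWfin : ∫⁻ ω, W ω ∂μ ≠ ⊤ := (hWint.trans_lt ENNReal.ofReal_lt_top).ne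
    have hVfin : ∫⁻ ω, V ω ∂μ ≠ ⊤ := (hVint.trans_lt ENNReal.ofReal_lt_top).ne
    have hsum : ∫⁻ ω, (W ω + V ω) ∂μ ≤ ENNReal.ofReal (B + B') := by
      rw [lintegral_add_left hWm, ENNReal.ofReal_add hB hB'0]
      exact add_le_add hWint hVint
    have hsumfin : ∫⁻ ω, (W ω + V ω) ∂μ ≠ ⊤ := (hsum.trans_lt ENNReal.ofReal_lt_top).ne
    have hsumm : Measurable fun ω => W ω + V ω := hWm.add hVm
    have hle : ∀ᵐ ω ∂μ, PERM.designNormSq PX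
        ((fbar ω : C(PERM.Cube d, ℝ)) - (f₀ : C(PERM.Cube d, ℝ)))
        ≤ K * (n : ℝ) ^ (-2 / (2 + β)) * (1 + p f₀ ^ α + (W ω + V ω).toReal) := by
      filter_upwards [hae, hbdd, ae_lt_top hWm hWfin, ae_lt_top hVm hVfin]
        with ω hω hQω hWω hVω
      have hf := apply_nonneg p (fbar ω)
      have hf0 := apply_nonneg p f₀
      have hp : 0 ≤ p f₀ ^ α := Real.rpow_nonneg hf0 α
      have hW0 : 0 ≤ (W ω).toReal := ENNReal.toReal_nonneg
      have hV0 : 0 ≤ (V ω).toReal := ENNReal.toReal_nonneg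
      have hP : 1 ≤ 1 + p (fbar ω) + p f₀ := by linarith
      have h1 := hV ω hVω.ne (fbar ω - f₀) (1 + p (fbar ω) + p f₀) hQω hP
        ((map_sub_le_add p (fbar ω) f₀).trans (by linarith))
      have h2 := hyoung (p (fbar ω)) (p f₀) (V ω).toReal hf hf0 hV0
      have hL : 0 ≤ Real.log (1 + (V ω).toReal) := Real.log_nonneg (by linarith)
      rw [ENNReal.toReal_add hWω.ne hVω.ne]
      set η : ℝ := (n : ℝ) ^ (-2 / (2 + β)) with hη
      have hη0 : 0 ≤ η := by positivity
      set S : ℝ := 1 + p f₀ ^ α + ((W ω).toReal + (V ω).toReal) with hS_def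
      have hPγ : 0 ≤ (1 + p (fbar ω) + p f₀) ^ γ := Real.rpow_nonneg (by linarith) γ
      have h3 : (1 + p (fbar ω) + p f₀) ^ γ * (1 + Real.log (1 + (V ω).toReal))
          ≤ (C + C') * S := by
        have e1 : (1 + p (fbar ω) + p f₀) ^ γ * (1 + Real.log (1 + (V ω).toReal))
            ≤ (1 + p (fbar ω) + p f₀) ^ γ * (1 + Real.log (1 + (V ω).toReal)) ^ 2 :=
          mul_le_mul_of_nonneg_left (le_self_pow₀ (by linarith) two_ne_zero) hPγ
        have e2 : C * (1 + p f₀ ^ α + (W ω).toReal) ≤ C * S :=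
          mul_le_mul_of_nonneg_left (by linarith) hC.le
        have e3 : C' * (1 + p f₀ ^ α + (V ω).toReal) ≤ C' * S :=
          mul_le_mul_of_nonneg_left (by linarith) hC'.le
        linarith [hω.2]
      have h4 : PERM.empiricalNormSq (fun i => X i ω)
          ((fbar ω : C(PERM.Cube d, ℝ)) - (f₀ : C(PERM.Cube d, ℝ))) ≤ C * η * S :=
        hω.1.trans (mul_le_mul_of_nonneg_left (by linarith) (by positivity))
      have h5 := mul_le_mul_of_nonneg_left h3 (mul_nonneg hM0.le hη0)
      have h6 : PERM.designNormSq PX ((fbar ω : C(PERM.Cube d, ℝ)) - (f₀ : C(PERM.Cube d, ℝ)))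
          ≤ 8 * PERM.empiricalNormSq (fun i => X i ω)
              ((fbar ω : C(PERM.Cube d, ℝ)) - (f₀ : C(PERM.Cube d, ℝ)))
            + M * (η * (1 + p (fbar ω) + p f₀) ^ γ) * (1 + Real.log (1 + (V ω).toReal)) := h1
      rw [hK]
      linarith
    have hint := PERM.integrable_of_le_affine hsumm hsumfin
      (hE.measurable_designNormSq PX f₀).aestronglyMeasurable
      (fun ω => integral_nonneg fun x => sq_nonneg _) hle
    refine ⟨hint, ?_⟩
    -- conditioning on the trivial sigma-algebra turns the conditional bound into an expectation
    have hcond := PERM.condExp_le_of_setLIntegral_le (m := ⊥) bot_le hsumm (add_nonneg hB hB'0)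
      (fun s hs => by
        rcases MeasurableSpace.measurableSet_bot_iff.1 hs with rfl | rfl
        · simp
        · simpa using hsum) hint (by positivity) hle
    rw [condExp_bot] at hcond
    obtain ⟨ω, hω⟩ := hcond.exists
    refine hω.trans ?_
    have hp : 0 ≤ p f₀ ^ α := Real.rpow_nonneg (apply_nonneg p f₀) α
    have hη : 0 ≤ K * (n : ℝ) ^ (-2 / (2 + β)) := by positivity
    calc K * (n : ℝ) ^ (-2 / (2 + β)) * (1 + p f₀ ^ α + (B + B'))
        ≤ K * (n : ℝ) ^ (-2 / (2 + β)) * ((1 + (B + B')) * (1 + p f₀ ^ α)) := by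
          gcongr
          nlinarith [mul_nonneg (add_nonneg hB hB'0) hp]
      _ = _ := by ring
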